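/- Setting. For an integer $S\ge 1$ let $\mathcal M_S$ be the set of probability vectors $P=(p_1,\dots,p_S)$ (zero entries allowed), and put $F_\alpha(P)=\sum_{i=1}^S p_i^\alpha$ and $H_\alpha(P)=\frac{\ln F_\alpha(P)}{1-\alpha}$ (Rényi entropy). In the Poisson sampling model with (real) sample size $n>0$ one observes independent counts $Z_i\sim\mathsf{Poi}(np_i)$, $1\le i\le S$. Each count is split: given $(Z_i)_i$, the variables $X_i\sim \mathsf B(Z_i,1/2)$ are drawn independently, and $Y_i=Z_i-X_i$. Estimator. Let $1<\alpha<3/2$, $m=n/2$, and let $c_1,c_2$ be constants with $c_1>16\alpha$ and $0<10\,c_2\ln 2<2\alpha-2$. Put $$\Delta=\frac{c_1\ln m}{m},\qquad K=\lfloor c_2\ln m\rfloor\ \ (K=0 \text{ if } m<1),\qquad t=\frac{\Delta}{4}.$$ Let $\sum_{k=0}^K g_kx^k$ be the best uniform approximation of $x^\alpha$ on $[0,1]$ by polynomials of degree at most $K$, and define $$S_K(x)=\sum_{k=1}^K g_k(4\Delta)^{-k+\alpha}\prod_{r=0}^{k-1}\Big(x-\frac rm\Big),\qquad L(x)=\min\{S_K(x),1\},\qquad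 U(x)=I(x)\Big(1+\frac{\alpha(1-\alpha)}{2mx}\Big)x^\alpha,$$ where $I(x)=0$ for $x\le t$, $I(x)=g\big(\tfrac{x-t}{t}\big)$ for $t<x<2t$, $I(x)=1$ for $x\ge 2t$, and $g(u)=126u^5-420u^6+540u^7-315u^8+70u^9$. The estimator of $F_\alpha(P)$ is $$\hat F_\alpha=\sum_{i=1}^S\Big[L(X_i/m)\,\mathbf 1\{Y_i/m\le 2\Delta\}+U(X_i/m)\,\mathbf 1\{Y_i/m>2\Delta\}\Big].$$ Theorem. For every $\alpha\in(1,3/2)$, all constants $c_1,c_2$ as above, every $\delta>0$ and every $\epsilon\in(0,1)$ there is a constant $c>0$, depending only on $\alpha,c_1,c_2,\delta,\epsilon$, such that $$\limsup_{S\to\infty}\ \sup_{P\in\mathcal M_S,\ n\ge cS/\ln S}\ \mathbb P\left(\left|\frac{\ln\hat F_\alpha}{1-\alpha}-H_\alpha(P)\right|\ge\delta\right)\le\epsilon,$$ where outcomes with $\hat F_\alpha\le 0$, for which $\ln\hat F_\alpha$ is not defined, are counted as belonging to the event. -/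

import Mathlib

open scoped ENNReal NNReal

noncomputable section

namespace RenyiEst

/-- The power sum `F_α(P) = ∑ᵢ pᵢ ^ α`. -/
def powerSum {S : ℕ} (α : ℝ) (p : Fin S → ℝ) : ℝ := ∑ i, p i ^ α

/-- The Rényi entropy `H_α(P) = ln F_α(P) / (1 - α)`. -/
def renyiEntropy {S : ℕ} (α : ℝ) (p : Fin S → ℝ) : ℝ :=
  Real.log (powerSum α p) / (1 - α)

/-- The uniform distance on `[0,1]` between the polynomial `q` and the function `x ^ α`. -/
def supError (α : ℝ) (q : Polynomial ℝ) : ℝ :=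
  ⨆ x : Set.Icc (0 : ℝ) 1, |q.eval (x : ℝ) - (x : ℝ) ^ α|

/-- `q` is a best uniform approximation of `x ^ α` on `[0,1]` among the real polynomials of degree
at most `K`. -/
def IsBestApprox (α : ℝ) (K : ℕ) (q : Polynomial ℝ) : Prop :=
  q.natDegree ≤ K ∧ ∀ r : Polynomial ℝ, r.natDegree ≤ K → supError α q ≤ supError α r

theorem exists_isBestApprox {α : ℝ} (hα : 0 < α) (K : ℕ) :
    ∃ q : Polynomial ℝ, IsBestApprox α K q := by
  let f : C(Set.Icc (0 : ℝ) 1, ℝ) :=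
    ⟨fun x => (x : ℝ) ^ α, continuous_subtype_val.rpow_const fun _ => Or.inr hα.le⟩
  let W : Submodule ℝ C(Set.Icc (0 : ℝ) 1, ℝ) :=
    (Polynomial.degreeLE ℝ K).map
      (Polynomial.toContinuousMapOnAlgHom (Set.Icc (0 : ℝ) 1)).toLinearMap
  have hfin : FiniteDimensional ℝ (Polynomial.degreeLE ℝ (K : WithBot ℕ)) := by
    rw [← Polynomial.degreeLT_succ_eq_degreeLE]
    exact Module.Finite.equiv (Polynomial.degreeLTEquiv ℝ (K + 1)).symm
  have hW : FiniteDimensional ℝ W := inferInstance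
  have hp : ProperSpace W := FiniteDimensional.proper ℝ W
  have herr : ∀ q : Polynomial ℝ, supError α q = ‖q.toContinuousMapOn (Set.Icc (0 : ℝ) 1) - f‖ := by
    intro q
    rw [ContinuousMap.norm_eq_iSup_norm]
    rfl
  have hcont : Continuous fun w : W => ‖(w : C(Set.Icc (0 : ℝ) 1, ℝ)) - f‖ := by fun_prop
  have htend : Filter.Tendsto (fun w : W => ‖(w : C(Set.Icc (0 : ℝ) 1, ℝ)) - f‖)
      (Filter.cocompact W) Filter.atTop := by
    have h1 : Filter.Tendsto (fun w : W => ‖w‖ - ‖f‖) (Filter.cocompact W) Filter.atTop :=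
      Filter.tendsto_atTop_add_const_right _ _ tendsto_norm_cocompact_atTop
    exact Filter.tendsto_atTop_mono (fun w => norm_sub_norm_le _ _) h1
  obtain ⟨w, hw⟩ := hcont.exists_forall_le htend
  obtain ⟨q, hq, hqw⟩ := (Submodule.mem_map).1 w.2
  refine ⟨q, Polynomial.natDegree_le_iff_degree_le.2 (Polynomial.mem_degreeLE.1 hq),
    fun r hr => ?_⟩
  have hr' : r.toContinuousMapOn (Set.Icc (0 : ℝ) 1) ∈ W :=
    Submodule.mem_map.2 ⟨r, Polynomial.mem_degreeLE.2
      (Polynomial.natDegree_le_iff_degree_le.1 hr), rfl⟩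
  have h := hw ⟨_, hr'⟩
  have hqw' : q.toContinuousMapOn (Set.Icc (0 : ℝ) 1) = (w : C(Set.Icc (0 : ℝ) 1, ℝ)) := hqw
  rw [herr, herr, hqw']
  exact h

/-- The best uniform approximation polynomial of `x ^ α` (`α > 0`) on `[0,1]` of degree at most
`K`. -/
def bestPoly (α : ℝ) (K : ℕ) : Polynomial ℝ :=
  if hα : 0 < α then (exists_isBestApprox hα K).choose else 0

/-- `Δ = c₁ ln m / m`. -/
def Delta (c₁ m : ℝ) : ℝ := c₁ * Real.log m / m

/-- `K`, the integer part of `c₂ ln m`. -/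
def order (c₂ m : ℝ) : ℕ := ⌊c₂ * Real.log m⌋₊

/-- `S_{K,α}(x) = ∑_{k=1}^K g_{k,α} (4Δ)^{-k+α} ∏_{r=0}^{k-1} (x - r/m)`, where `g_{k,α}` are the
coefficients of the best polynomial approximation of degree at most `K`. -/
def lowerPoly (α c₁ c₂ m x : ℝ) : ℝ :=
  ∑ k ∈ Finset.Icc 1 (order c₂ m),
    (bestPoly α (order c₂ m)).coeff k * (4 * Delta c₁ m) ^ (-(k : ℝ) + α) *
      ∏ r ∈ Finset.range k, (x - (r : ℝ) / m)

/-- `L_α(x) = min {S_{K,α}(x), 1}`. -/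
def lowerPart (α c₁ c₂ m x : ℝ) : ℝ := min (lowerPoly α c₁ c₂ m x) 1

/-- The interpolating polynomial `g(x; a)`. -/
def smoothStep (x a : ℝ) : ℝ :=
  126 * (x / a) ^ 5 - 420 * (x / a) ^ 6 + 540 * (x / a) ^ 7 - 315 * (x / a) ^ 8 + 70 * (x / a) ^ 9

/-- The interpolation function: `0` for `x ≤ t`, `g(x - t; t)` for `t < x < 2t`, and `1` for
`x ≥ 2t`. -/
def interp (t x : ℝ) : ℝ :=
  if x ≤ t then 0 else if x < 2 * t then smoothStep (x - t) t else 1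

/-- `U_α(x) = I(x) (1 + α(1-α)/(2mx)) x^α`, with the interpolation function at `t = Δ/4`. -/
def upperPart (α c₁ m x : ℝ) : ℝ :=
  interp (Delta c₁ m / 4) x * (1 + α * (1 - α) / (2 * m * x)) * x ^ α

/-- The estimator of `F_α` computed from the split counts `(Xᵢ, Yᵢ)`, where `m` is half of the
sample size. -/
def estimator {S : ℕ} (α c₁ c₂ m : ℝ) (xy : Fin S → ℕ × ℕ) : ℝ :=
  ∑ i, if ((xy i).2 : ℝ) / m ≤ 2 * Delta c₁ m
    then lowerPart α c₁ c₂ m (((xy i).1 : ℝ) / m)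
    else upperPart α c₁ m (((xy i).1 : ℝ) / m)

/-- The law of `(T, Z - T)` where `Z` is Poisson with mean `lam` and, given `Z`, the variable `T`
is binomial with parameters `Z` and `1/2`. -/
def splitLaw (lam : ℝ≥0) : MeasureTheory.Measure (ℕ × ℕ) :=
  (ProbabilityTheory.poissonMeasure lam).bind fun z =>
    (ProbabilityTheory.binomial z ⟨1 / 2, by norm_num, by norm_num⟩).map fun t => (t, z - t)

/-- The law of the split counts `(Xᵢ, Yᵢ)`, `i = 1, …, S`, in the Poisson sampling model with
sample size `n`: the counts `Zᵢ` are independent Poisson variables with means `n pᵢ`, and each is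
split by independent fair coin flips. -/
def sampleLaw {S : ℕ} (n : ℝ) (p : Fin S → ℝ) : MeasureTheory.Measure (Fin S → ℕ × ℕ) :=
  MeasureTheory.Measure.pi fun i => splitLaw (n * p i).toNNReal

/-- The event that the plug-in estimator `(ln F̂_α)/(1-α)`, at sample size `n`, fails to approximate
`H_α(P)` within `δ`. If `F̂_α ≤ 0` then the logarithm is not defined and the estimator fails. -/
def failureEvent {S : ℕ} (α c₁ c₂ δ n : ℝ) (p : Fin S → ℝ) : Set (Fin S → ℕ × ℕ) :=
  {xy | estimator α c₁ c₂ (n / 2) xy ≤ 0 ∨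
    δ ≤ |Real.log (estimator α c₁ c₂ (n / 2) xy) / (1 - α) - renyiEntropy α p|}

end RenyiEst

end

namespace RenyiEst

/-! Write `F = F_α(P)`, `m = n/2` and `λ = c₁ ln m = mΔ`. The logarithm sees only relative errors,
so it suffices that the estimator lies within `η F` of `F` outside an event of probability `ε`, for
some small `η` depending on `δ` and `α`. Convexity gives `F ≥ S^(1-α)`, and errors that are not
proportional to `F` are measured against this quantity. By Poisson thinning (`splitLaw_eq_prod`),
`Xᵢ` and `Yᵢ` are independent Poisson variables of mean `m pᵢ`, so the choice of branch is
independent of the value that is used.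

The error of symbol `i` is split as `polyErr + restErr`, where `polyErr` is the error of the
polynomial branch for `pᵢ ≤ 4Δ`. The remainders are controlled in `L¹` (`integral_abs_restErr_le`):
the plug-in branch has relative error `O(λ^(-1/2))` once `p ≥ Δ`, and a wrong branch costs a
probability exponentially small in `λ`. Crude bounds on the interpolation and on the bias correction
are enough here.

The sum of the `polyErr` is handled by Chebyshev's inequality. Falling factorials estimate powers
without bias, so the bias comes from the uniform approximation error `O(K^(-2α))`; scaled by
`(4Δ)^α` it is `O((m ln m)^(-α))` per symbol. The total `S (m ln m)^(-α)` is a small fraction of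
`S^(1-α)` when `S` is at most a small multiple of `m ln m`. This is the only error that does not
vanish asymptotically, and it fixes `c`. The coefficients of the best polynomial have `ℓ¹` norm at
most `2·6^K`, which gives second moments `O(Δ^(2α) 2^(10K))`. Since `2^(10K) ≤ m^(2α-2)`, the
relative variance is at most `m^(2α-3)` up to logarithms, which tends to zero because `α < 3/2`.
Truncating the polynomial at 1 changes it by at most its square, so the same moment bound covers the
truncation.

The approximation rate comes from `x = cos² φ`: the Fourier coefficients of `|cos φ|^(2α)` obey a
two-term recurrence, which bounds their tails by telescoping. -/

/-! ### Coefficients of polynomials bounded on the unit interval; the best approximation -/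

open Polynomial in
-- Transplanted to `[-1,1]` by `x = (1-y)/2`, the point `x = 0` becomes `y = 1`, where Chebyshev
-- polynomials maximise every derivative among polynomials bounded by 1. The Taylor coefficients at
-- 1 are thus dominated by those of `T_n`, and summing them with weights `2^k` evaluates `T_n` at 3.
-- The base 6 comes from `T_{m+2}(3) = 6 T_{m+1}(3) - T_m(3)`.
theorem sum_abs_coeff_le_of_abs_eval_le {n : ℕ} {q : ℝ[X]} {B : ℝ} (hB : 0 < B)
    (hq : q.natDegree ≤ n) (hbd : ∀ x ∈ Set.Icc (0 : ℝ) 1, |q.eval x| ≤ B) :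
    ∑ k ∈ Finset.range (n + 1), |q.coeff k| ≤ B * 6 ^ n := by
  have hT3 : ∀ m : ℕ, 1 ≤ (Chebyshev.T ℝ m).eval 3 :=
    fun m => Chebyshev.one_le_eval_T_real m (by norm_num)
  have hT : ∀ m : ℕ, (Chebyshev.T ℝ m).eval 3 ≤ 6 ^ m := by
    intro m
    induction m with
    | zero => simp
    | succ m ih =>
      rcases m with _ | m
      · norm_num
      · have h := congrArg (eval 3) (Chebyshev.T_add_two ℝ (m : ℤ))
        simp only [eval_sub, eval_mul, eval_X, eval_ofNat] at h
        push_cast at ih h ⊢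
        have := hT3 m
        rw [add_assoc, one_add_one_eq_two, h, pow_succ]
        linarith
  set P : ℝ[X] := C B⁻¹ * q.comp (C (1 / 2) - C (1 / 2) * X) with hP
  have hPeval : ∀ y, P.eval y = B⁻¹ * q.eval (1 / 2 - 1 / 2 * y) := by
    intro y; simp [hP, eval_comp]
  have hPdeg : P.degree ≤ n := by
    refine natDegree_le_iff_degree_le.1 ((natDegree_C_mul_le _ _).trans ?_)
    refine natDegree_comp_le.trans ?_
    have : (C (1 / 2 : ℝ) - C (1 / 2) * X).natDegree ≤ 1 := by compute_degree
    nlinarith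
  have hPdeg' : (-P).degree ≤ n := by rwa [degree_neg]
  have hPb : ∀ y ∈ Set.Icc (-1 : ℝ) 1, |P.eval y| ≤ 1 := by
    intro y hy
    rw [hPeval, abs_mul, abs_of_pos (inv_pos.2 hB), inv_mul_le_iff₀ hB, mul_one]
    exact hbd _ ⟨by linarith [hy.2], by linarith [hy.1]⟩
  have hcoef : ∀ k, |(taylor 1 P).coeff k| ≤ (taylor 1 (Chebyshev.T ℝ n)).coeff k := by
    intro k
    have key : ∀ Q : ℝ[X], (k.factorial : ℝ) * (taylor 1 Q).coeff k
        = (derivative^[k] Q).eval 1 := by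
      intro Q
      rw [taylor_coeff, ← factorial_smul_hasseDeriv]
      simp
    have h1 := Chebyshev.eval_iterate_derivative_le_of_forall_abs_le_one (k := k) le_rfl hPdeg hPb
    have h2 := Chebyshev.eval_iterate_derivative_le_of_forall_abs_le_one (k := k) le_rfl hPdeg'
      (by simpa using hPb)
    rw [← key, ← key] at h1 h2
    have hk : (0 : ℝ) < k.factorial := by positivity
    have h1 := le_of_mul_le_mul_left h1 hk
    have h2 := le_of_mul_le_mul_left h2 hk
    rw [map_neg, coeff_neg] at h2
    exact abs_le.2 ⟨by linarith, h1⟩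
  have hqP : q = C B * (taylor 1 P).comp (C (-2) * X) := by
    apply Polynomial.funext
    intro x
    rw [eval_mul, eval_C, eval_comp, taylor_eval, hPeval]
    simp only [eval_mul, eval_C, eval_X]
    rw [← mul_assoc, mul_inv_cancel₀ hB.ne', one_mul]
    congr 1; ring
  calc ∑ k ∈ Finset.range (n + 1), |q.coeff k|
      ≤ ∑ k ∈ Finset.range (n + 1), B * ((taylor 1 (Chebyshev.T ℝ n)).coeff k * 2 ^ k) := by
        refine Finset.sum_le_sum fun k _ => ?_
        rw [hqP, coeff_C_mul, comp_C_mul_X_coeff, abs_mul, abs_mul, abs_of_pos hB, abs_pow]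
        norm_num
        gcongr
        exact hcoef k
    _ = B * (taylor 1 (Chebyshev.T ℝ n)).eval 2 := by
        rw [← Finset.mul_sum, eval_eq_sum_range' (n := n + 1)]
        rw [natDegree_taylor, Chebyshev.natDegree_T]
        simp
    _ ≤ B * 6 ^ n := by
        rw [taylor_eval]
        have := hT n
        norm_num at this ⊢
        gcongr

theorem bddAbove_supError {α : ℝ} (hα : 0 < α) (q : Polynomial ℝ) :
    BddAbove (Set.range fun x : Set.Icc (0 : ℝ) 1 => |q.eval (x : ℝ) - (x : ℝ) ^ α|) := by
  have hc : Continuous fun x : Set.Icc (0 : ℝ) 1 => |q.eval (x : ℝ) - (x : ℝ) ^ α| := by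
    have := continuous_subtype_val.rpow_const (p := α)
      (f := fun x : Set.Icc (0 : ℝ) 1 => (x : ℝ)) fun _ => Or.inr hα.le
    have h2 : Continuous fun x : Set.Icc (0 : ℝ) 1 => q.eval (x : ℝ) :=
      q.continuous.comp continuous_subtype_val
    exact (h2.sub this).abs
  exact (isCompact_range hc).bddAbove

theorem isBestApprox_bestPoly {α : ℝ} (hα : 0 < α) (K : ℕ) :
    IsBestApprox α K (bestPoly α K) := by
  rw [bestPoly, dif_pos hα]
  exact (exists_isBestApprox hα K).choose_spec

theorem abs_eval_bestPoly_sub_le {α E : ℝ} (hα : 0 < α) {K : ℕ} {r : Polynomial ℝ}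
    (hr : r.natDegree ≤ K) (hE : ∀ x ∈ Set.Icc (0 : ℝ) 1, |r.eval x - x ^ α| ≤ E)
    {x : ℝ} (hx : x ∈ Set.Icc (0 : ℝ) 1) :
    |(bestPoly α K).eval x - x ^ α| ≤ E := by
  have h1 : |(bestPoly α K).eval x - x ^ α| ≤ supError α (bestPoly α K) :=
    le_ciSup (bddAbove_supError hα (bestPoly α K)) ⟨x, hx⟩
  have h2 : supError α r ≤ E := by
    have : Nonempty (Set.Icc (0 : ℝ) 1) := ⟨⟨x, hx⟩⟩
    exact ciSup_le fun y => hE y y.2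
  exact h1.trans (((isBestApprox_bestPoly hα K).2 r hr).trans h2)

theorem sum_abs_coeff_bestPoly_le {α : ℝ} (hα : 0 < α) (K : ℕ) :
    ∑ k ∈ Finset.range (K + 1), |(bestPoly α K).coeff k| ≤ 2 * 6 ^ K := by
  refine sum_abs_coeff_le_of_abs_eval_le two_pos (isBestApprox_bestPoly hα K).1 fun x hx => ?_
  have h0 : ∀ y ∈ Set.Icc (0 : ℝ) 1, |y ^ α| ≤ 1 := fun y hy => by
    rw [abs_of_nonneg (Real.rpow_nonneg hy.1 _)]
    exact Real.rpow_le_one hy.1 hy.2 hα.le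
  have h := abs_eval_bestPoly_sub_le hα (r := 0) (K := K) (E := 1) (by simp)
    (fun y hy => by simpa using h0 y hy) hx
  have h2 := h0 x hx
  have := abs_add_le ((bestPoly α K).eval x - x ^ α) (x ^ α)
  simp only [sub_add_cancel] at this
  linarith

/-! ### Uniform approximation of `x ^ α` at rate `K ^ (-2α)`, by Fourier series -/

/-- The recurrence says `2α e_k = (k+α) e_k - (k+1+α) e_{k+1}`, so the tail telescopes. -/
theorem tail_sum_le_of_recurrence {α : ℝ} (hα : 0 < α) {e : ℕ → ℝ} (he : ∀ k, 0 ≤ e k)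
    (hrec : ∀ k : ℕ, 2 ≤ k → (k + 1 + α) * e (k + 1) = (k - α) * e k) {N : ℕ} (hN : 2 ≤ N) :
    Summable (fun j => e (j + N)) ∧ ∑' j, e (j + N) ≤ (N + α) * e N / (2 * α) := by
  have hsum : ∀ M : ℕ, ∑ j ∈ Finset.range M, e (j + N)
      = ((N + α) * e N - ((M + N : ℕ) + α) * e (M + N)) / (2 * α) := by
    intro M
    induction M with
    | zero => simp
    | succ M ih =>
      rw [Finset.sum_range_succ, ih]
      have h := hrec (M + N) (by omega)
      rw [show M + 1 + N = M + N + 1 by ring, eq_div_iff (by positivity), add_mul,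
        div_mul_cancel₀ _ (by positivity)]
      push_cast at h ⊢
      linear_combination h
  have hle : ∀ M : ℕ, ∑ j ∈ Finset.range M, e (j + N) ≤ (N + α) * e N / (2 * α) := by
    intro M
    rw [hsum M]
    have := he (M + N)
    gcongr
    exact sub_le_self _ (by positivity)
  exact ⟨summable_of_sum_range_le (fun j => he _) hle,
    Real.tsum_le_of_sum_range_le (fun j => he _) hle⟩

theorem two_mul_le_log_div {x : ℝ} (hx₀ : 0 ≤ x) (hx₁ : x < 1) :
    2 * x ≤ Real.log (1 + x) - Real.log (1 - x) := by
  have h := Real.hasSum_log_sub_log_of_abs_lt_one (x := x) (by rwa [abs_of_nonneg hx₀])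
  have := sum_le_hasSum (Finset.range 1) (fun i _ => by positivity) h
  simpa using this

/-- In logarithms: `2α ln(1+1/k) ≤ 2α/k ≤ ln((1+α/k)/(1-α/k))`. It makes `(k+α) e_k k^(2α)`
nonincreasing along the recurrence. -/
theorem sub_mul_succ_rpow_le {α : ℝ} (hα₀ : 0 < α) {k : ℕ} (hk : α < k) :
    (k - α) * ((k + 1 : ℕ) : ℝ) ^ (2 * α) ≤ (k + α) * (k : ℝ) ^ (2 * α) := by
  have hk0 : (0 : ℝ) < k := hα₀.trans hk
  have hx1 : α / k < 1 := (div_lt_one hk0).2 hk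
  have h1 : (1 + 1 / (k : ℝ)) ^ (2 * α) ≤ (1 + α / k) / (1 - α / k) := by
    rw [Real.rpow_def_of_pos (by positivity), ← Real.le_log_iff_exp_le
      (div_pos (by positivity) (by linarith)), Real.log_div (by positivity) (by linarith)]
    refine le_trans ?_ (two_mul_le_log_div (by positivity) hx1)
    have := Real.log_le_sub_one_of_pos (x := 1 + 1 / (k : ℝ)) (by positivity)
    calc Real.log (1 + 1 / (k : ℝ)) * (2 * α) ≤ (1 / k) * (2 * α) := by
          gcongr; linarith
      _ = 2 * (α / k) := by ring
  rw [le_div_iff₀ (by linarith)] at h1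
  have h2 : ((k + 1 : ℕ) : ℝ) = k * (1 + 1 / k) := by
    push_cast; field_simp
  rw [h2, Real.mul_rpow hk0.le (by positivity)]
  have h3 : (k - α) = k * (1 - α / k) := by field_simp
  have h4 : (k + α) = k * (1 + α / k) := by field_simp
  rw [h3, h4]
  have : 0 ≤ (k : ℝ) * (k : ℝ) ^ (2 * α) := by positivity
  nlinarith

theorem decay_of_recurrence {α : ℝ} (hα₀ : 0 < α) (hα : α < 2) {e : ℕ → ℝ} (he : ∀ k, 0 ≤ e k)
    (hrec : ∀ k : ℕ, 2 ≤ k → (k + 1 + α) * e (k + 1) = (k - α) * e k) {k : ℕ} (hk : 2 ≤ k) :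
    (k + α) * e k ≤ (2 + α) * e 2 * 2 ^ (2 * α) * (k : ℝ) ^ (-(2 * α)) := by
  have key : (k + α) * e k * (k : ℝ) ^ (2 * α) ≤ (2 + α) * e 2 * 2 ^ (2 * α) := by
    induction k, hk using Nat.le_induction with
    | base => simp
    | succ k hk ih =>
      have hk' : α < k := hα.trans_le (by exact_mod_cast hk)
      have h := sub_mul_succ_rpow_le hα₀ hk'
      refine le_trans ?_ ih
      have h2 := hrec k hk
      calc (((k + 1 : ℕ) : ℝ) + α) * e (k + 1) * ((k + 1 : ℕ) : ℝ) ^ (2 * α)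
          = e k * ((k - α) * ((k + 1 : ℕ) : ℝ) ^ (2 * α)) := by
            push_cast; rw [h2]; ring
        _ ≤ e k * ((k + α) * (k : ℝ) ^ (2 * α)) := by gcongr; exact he k
        _ = _ := by ring
  have hkpos : (0 : ℝ) < k := by positivity
  rw [Real.rpow_neg hkpos.le, ← div_eq_mul_inv, le_div_iff₀ (by positivity)]
  exact key

/-- The function `|cos φ| ^ (2 α)` on the circle of length `π`. -/
noncomputable def cosPow (α : ℝ) (hα : 0 < α) : C(AddCircle Real.pi, ℂ) where
  toFun := Function.Periodic.lift (f := fun φ : ℝ => ((|Real.cos φ| ^ (2 * α) : ℝ) : ℂ))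
    (c := Real.pi) (fun φ => by simp)
  continuous_toFun := by
    refine Continuous.quotient_liftOn' ?_ _
    exact Complex.continuous_ofReal.comp
      (Real.continuous_cos.abs.rpow_const fun _ => Or.inr (by positivity))

theorem cosPow_coe {α : ℝ} (hα : 0 < α) (φ : ℝ) :
    cosPow α hα (φ : AddCircle Real.pi) = ((|Real.cos φ| ^ (2 * α) : ℝ) : ℂ) := rfl

/-- The function `cos^(2α+1) φ · e^(-i(2k+1)φ)` vanishes at both endpoints. Its derivative, written
with `e^(±iφ) = cos φ ± i sin φ`, is a combination of the two integrands. -/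
theorem integral_cosPow_recurrence {α : ℝ} (hα : 0 < α) (k : ℤ) :
    (α + k + 1) * ∫ φ in (-(Real.pi / 2))..(Real.pi / 2),
        Complex.exp (-(2 * (k + 1) * φ * Complex.I)) * ((|Real.cos φ| ^ (2 * α) : ℝ) : ℂ)
      = (α - k) * ∫ φ in (-(Real.pi / 2))..(Real.pi / 2),
        Complex.exp (-(2 * k * φ * Complex.I)) * ((|Real.cos φ| ^ (2 * α) : ℝ) : ℂ) := by
  have hcont : ∀ j : ℂ, Continuous fun φ : ℝ =>
      Complex.exp (-(2 * j * φ * Complex.I)) * ((|Real.cos φ| ^ (2 * α) : ℝ) : ℂ) := by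
    intro j
    refine Continuous.mul (by fun_prop) (Complex.continuous_ofReal.comp
      (Real.continuous_cos.abs.rpow_const fun _ => Or.inr (by positivity)))
  set h : ℝ → ℂ := fun φ => ((Real.cos φ ^ (2 * α + 1) : ℝ) : ℂ) *
    Complex.exp (-((2 * k + 1) * φ * Complex.I)) with hh
  set h' : ℝ → ℂ := fun φ => Complex.I * ((α - k) *
      (Complex.exp (-(2 * k * φ * Complex.I)) * ((|Real.cos φ| ^ (2 * α) : ℝ) : ℂ))
    - (α + k + 1) * (Complex.exp (-(2 * (k + 1) * φ * Complex.I)) *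
      ((|Real.cos φ| ^ (2 * α) : ℝ) : ℂ))) with hh'
  have hcont' : Continuous h' :=
    continuous_const.mul ((continuous_const.mul (hcont k)).sub
      (continuous_const.mul (hcont (k + 1))))
  have hder : ∀ φ ∈ Set.uIcc (-(Real.pi / 2)) (Real.pi / 2), HasDerivAt h (h' φ) φ := by
    intro φ hφ
    rw [Set.uIcc_of_le (by linarith [Real.pi_pos])] at hφ
    have hcos : 0 ≤ Real.cos φ := Real.cos_nonneg_of_mem_Icc hφ
    have h1 := ((Real.hasDerivAt_cos φ).rpow_const (p := 2 * α + 1)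
      (Or.inr (by linarith))).ofReal_comp
    have h2 : HasDerivAt (fun φ : ℝ => Complex.exp (-((2 * k + 1) * φ * Complex.I)))
        (Complex.exp (-((2 * k + 1) * φ * Complex.I)) * (-((2 * k + 1) * Complex.I))) φ := by
      have h3 : HasDerivAt (fun φ : ℝ => -((2 * (k : ℂ) + 1) * (φ : ℂ) * Complex.I))
          (-((2 * k + 1) * Complex.I)) φ := by
        have := ((Complex.ofRealCLM.hasDerivAt (x := φ)).const_mul (2 * (k : ℂ) + 1)).mul_const
          Complex.I |>.fun_neg
        simpa using this
      exact h3.cexp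
    refine (h1.mul h2).congr_deriv ?_
    simp only [hh', abs_of_nonneg hcos, add_sub_cancel_right]
    have hp : Real.cos φ ^ (2 * α + 1) = Real.cos φ ^ (2 * α) * Real.cos φ :=
      Real.rpow_add_one' hcos (by positivity)
    rw [hp]
    have e1 : Complex.exp (-(2 * k * φ * Complex.I))
        = Complex.exp (-((2 * k + 1) * φ * Complex.I)) * (Real.cos φ + Real.sin φ * Complex.I) := by
      rw [Complex.ofReal_cos, Complex.ofReal_sin, ← Complex.exp_mul_I, ← Complex.exp_add]
      congr 1; ring
    have e2 : Complex.exp (-(2 * (k + 1) * φ * Complex.I))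
        = Complex.exp (-((2 * k + 1) * φ * Complex.I)) * (Real.cos φ - Real.sin φ * Complex.I) := by
      have : (Real.cos φ - Real.sin φ * Complex.I : ℂ)
          = Real.cos (-φ) + Real.sin (-φ) * Complex.I := by
        rw [Real.cos_neg, Real.sin_neg]; push_cast; ring
      rw [this, Complex.ofReal_cos, Complex.ofReal_sin, ← Complex.exp_mul_I, ← Complex.exp_add]
      congr 1; push_cast; ring
    rw [e1, e2]
    push_cast
    have hI : Complex.I * Complex.I = -1 := Complex.I_mul_I
    linear_combination -(Complex.exp (-((2 * k + 1) * φ * Complex.I)) *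
      ((Real.cos φ ^ (2 * α) : ℝ) : ℂ) * Complex.sin φ * (2 * α + 1)) * hI
  have hint := intervalIntegral.integral_eq_sub_of_hasDerivAt hder
    (hcont'.intervalIntegrable _ _)
  have hz : h (Real.pi / 2) - h (-(Real.pi / 2)) = 0 := by
    simp only [hh, Real.cos_neg, Real.cos_pi_div_two]
    rw [Real.zero_rpow (by positivity)]
    simp
  rw [hz, hh'] at hint
  have hi : ∀ a j : ℂ, IntervalIntegrable (fun φ : ℝ =>
      a * (Complex.exp (-(2 * j * φ * Complex.I)) * ((|Real.cos φ| ^ (2 * α) : ℝ) : ℂ)))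
      MeasureTheory.volume (-(Real.pi / 2)) (Real.pi / 2) :=
    fun a j => (continuous_const.mul (hcont j)).intervalIntegrable _ _
  rw [intervalIntegral.integral_const_mul, intervalIntegral.integral_sub (hi _ _) (hi _ _),
    intervalIntegral.integral_const_mul, intervalIntegral.integral_const_mul] at hint
  have := (mul_eq_zero.1 hint).resolve_left Complex.I_ne_zero
  exact (sub_eq_zero.1 this).symm

instance fact_pi_pos : Fact (0 < Real.pi) := ⟨Real.pi_pos⟩

theorem fourierCoeff_cosPow {α : ℝ} (hα : 0 < α) (k : ℤ) :
    fourierCoeff (cosPow α hα) k = (1 / Real.pi) • ∫ φ in (-(Real.pi / 2))..(Real.pi / 2),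
        Complex.exp (-(2 * k * φ * Complex.I)) * ((|Real.cos φ| ^ (2 * α) : ℝ) : ℂ) := by
  rw [fourierCoeff_eq_intervalIntegral _ _ (-(Real.pi / 2))]
  rw [show -(Real.pi / 2) + Real.pi = Real.pi / 2 by ring]
  congr 1
  refine intervalIntegral.integral_congr fun φ _ => ?_
  simp only [smul_eq_mul, fourier_coe_apply, cosPow_coe]
  congr 2
  have : (Real.pi : ℂ) ≠ 0 := by exact_mod_cast Real.pi_ne_zero
  field_simp
  push_cast
  ring

theorem fourierCoeff_cosPow_recurrence {α : ℝ} (hα : 0 < α) (k : ℤ) :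
    (α + k + 1) * fourierCoeff (cosPow α hα) (k + 1)
      = (α - k) * fourierCoeff (cosPow α hα) k := by
  rw [fourierCoeff_cosPow, fourierCoeff_cosPow, mul_smul_comm, mul_smul_comm]
  have := integral_cosPow_recurrence hα k
  push_cast
  rw [this]

/-- The recurrence at `-k-1` is the recurrence at `k` read backwards, so symmetry propagates from `k
= 0`. -/
theorem fourierCoeff_cosPow_neg {α : ℝ} (hα : 0 < α) (k : ℕ) :
    fourierCoeff (cosPow α hα) (-k) = fourierCoeff (cosPow α hα) k := by
  induction k with
  | zero => simp
  | succ k ih =>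
    have h1 := fourierCoeff_cosPow_recurrence hα k
    have h2 := fourierCoeff_cosPow_recurrence hα (-k - 1)
    rw [sub_add_cancel, ih] at h2
    have hne : ((α : ℂ) + k + 1) ≠ 0 := by
      have : α + k + 1 ≠ 0 := by positivity
      exact_mod_cast this
    push_cast at h1 h2 ⊢
    rw [show -((k : ℤ) + 1) = -k - 1 by ring]
    apply mul_left_cancel₀ hne
    rw [h1]
    linear_combination -h2

/-- With `x = cos² φ` one has `x^α = |cos φ|^(2α)` and `cos 2kφ = T_k(2x-1)`, so a truncated Fourier
series is a polynomial in `x`. The truncation error is a tail of the coefficients. -/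
theorem exists_polynomial_approx_rpow {α : ℝ} (hα₀ : 0 < α) (hα : α < 2) :
    ∃ C : ℝ, 0 ≤ C ∧ ∀ K : ℕ, 1 ≤ K → ∃ q : Polynomial ℝ, q.natDegree ≤ K ∧
      ∀ x ∈ Set.Icc (0 : ℝ) 1, |q.eval x - x ^ α| ≤ C * (K : ℝ) ^ (-(2 * α)) := by
  set c : ℤ → ℂ := fourierCoeff (cosPow α hα₀) with hc
  set e : ℕ → ℝ := fun k => ‖c k‖ with he
  have he0 : ∀ k, 0 ≤ e k := fun k => norm_nonneg _
  have hrec : ∀ k : ℕ, 2 ≤ k → (k + 1 + α) * e (k + 1) = (k - α) * e k := by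
    intro k hk
    have h := congrArg norm (fourierCoeff_cosPow_recurrence hα₀ (k : ℤ))
    rw [norm_mul, norm_mul] at h
    have hk' : α ≤ k := hα.le.trans (by exact_mod_cast hk)
    have n1 : ‖(α : ℂ) + (k : ℤ) + 1‖ = k + 1 + α := by
      rw [show (α : ℂ) + (k : ℤ) + 1 = ((k + 1 + α : ℝ) : ℂ) by push_cast; ring,
        Complex.norm_real, Real.norm_of_nonneg (by positivity)]
    have n2 : ‖(α : ℂ) - (k : ℤ)‖ = k - α := by
      rw [show (α : ℂ) - (k : ℤ) = ((α - k : ℝ) : ℂ) by push_cast; ring,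
        Complex.norm_real, Real.norm_eq_abs, abs_sub_comm, abs_of_nonneg (by linarith)]
    rw [n1, n2] at h
    simpa [he] using h
  have hesum : Summable e := (summable_nat_add_iff 2).1 (tail_sum_le_of_recurrence hα₀ he0 hrec
    le_rfl).1
  have hcsum : Summable c := by
    refine Summable.of_nat_of_neg (Summable.of_norm hesum) ?_
    simp_rw [hc, fourierCoeff_cosPow_neg]
    exact Summable.of_norm hesum
  set a : ℕ → ℝ := fun k => (c k).re with ha
  -- Pairing `k` with `-k` over all natural `k` counts the constant term twice, hence the extra `a
  -- 0`.
  have hser : ∀ φ : ℝ, HasSum (fun k : ℕ => 2 * a k * Real.cos (2 * k * φ))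
      (|Real.cos φ| ^ (2 * α) + a 0) := by
    intro φ
    have h := (has_pointwise_sum_fourier_series_of_summable hcsum (φ : AddCircle Real.pi)).nat_add_neg
    have h2 := Complex.hasSum_re h
    convert h2 using 1
    · funext k
      rw [fourierCoeff_cosPow_neg]
      simp only [smul_eq_mul, fourier_coe_apply]
      rw [← mul_add]
      have hpi : (Real.pi : ℂ) ≠ 0 := by exact_mod_cast Real.pi_ne_zero
      have hcos : Complex.exp (2 * Real.pi * Complex.I * ((k : ℤ) : ℂ) * φ / Real.pi)
          + Complex.exp (2 * Real.pi * Complex.I * ((-(k : ℤ) : ℤ) : ℂ) * φ / Real.pi)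
          = ((2 * Real.cos (2 * k * φ) : ℝ) : ℂ) := by
        push_cast
        rw [Complex.cos]
        rw [show 2 * (Real.pi : ℂ) * Complex.I * (k : ℂ) * φ / Real.pi = 2 * k * φ * Complex.I by
          field_simp, show 2 * (Real.pi : ℂ) * Complex.I * (-(k : ℂ)) * φ / Real.pi
            = -(2 * k * φ) * Complex.I by field_simp]
        ring
      rw [hcos, Complex.re_mul_ofReal]
      simp only [ha, hc]
      ring
    · rw [cosPow_coe]
      simp [ha, hc]
  refine ⟨2 * ((2 + α) * e 2 * 2 ^ (2 * α) / (2 * α)), by have := he0 2; positivity,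
    fun K hK => ?_⟩
  refine ⟨(∑ k ∈ Finset.range (K + 1), Polynomial.C (2 * a k) *
    (Polynomial.Chebyshev.T ℝ k).comp (Polynomial.C 2 * Polynomial.X - Polynomial.C 1))
      - Polynomial.C (a 0), ?_, fun x hx => ?_⟩
  · refine (Polynomial.natDegree_sub_C).trans_le ?_
    refine Polynomial.natDegree_sum_le_of_forall_le _ _ fun k hk => ?_
    refine (Polynomial.natDegree_C_mul_le _ _).trans (Polynomial.natDegree_comp_le.trans ?_)
    rw [Polynomial.Chebyshev.natDegree_T]
    have : (Polynomial.C (2 : ℝ) * Polynomial.X - Polynomial.C 1).natDegree ≤ 1 := by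
      compute_degree
    have hk' := Finset.mem_range.1 hk
    simp only [Int.natAbs_natCast]
    nlinarith
  · set φ := Real.arccos (Real.sqrt x) with hφ
    have hs1 : Real.sqrt x ≤ 1 := Real.sqrt_le_one.2 hx.2
    have hcosφ : Real.cos φ = Real.sqrt x :=
      Real.cos_arccos (by linarith [Real.sqrt_nonneg x]) hs1
    have hx2 : 2 * x - 1 = Real.cos (2 * φ) := by
      rw [Real.cos_two_mul, hcosφ, Real.sq_sqrt hx.1]
    have hxα : |Real.cos φ| ^ (2 * α) = x ^ α := by
      rw [hcosφ, abs_of_nonneg (Real.sqrt_nonneg x), Real.rpow_mul (Real.sqrt_nonneg x)]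
      congr 1
      exact_mod_cast Real.sq_sqrt hx.1
    have h := hser φ
    rw [hxα] at h
    have htail := (hasSum_nat_add_iff' (K + 1)).2 h
    have heval : (∑ k ∈ Finset.range (K + 1), Polynomial.C (2 * a k) *
        (Polynomial.Chebyshev.T ℝ k).comp (Polynomial.C 2 * Polynomial.X - Polynomial.C 1)
          - Polynomial.C (a 0)).eval x
        = (∑ k ∈ Finset.range (K + 1), 2 * a k * Real.cos (2 * k * φ)) - a 0 := by
      rw [Polynomial.eval_sub, Polynomial.eval_C, Polynomial.eval_finsetSum]
      congr 1
      refine Finset.sum_congr rfl fun k _ => ?_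
      rw [Polynomial.eval_mul, Polynomial.eval_C, Polynomial.eval_comp]
      simp only [Polynomial.eval_sub, Polynomial.eval_mul, Polynomial.eval_C, Polynomial.eval_X]
      rw [hx2, Polynomial.Chebyshev.T_real_cos]
      congr 2
      push_cast; ring
    obtain ⟨hs, ht⟩ := tail_sum_le_of_recurrence hα₀ he0 hrec (N := K + 1) (by omega)
    have hb : ‖∑' j, 2 * a (j + (K + 1)) * Real.cos (2 * ((j + (K + 1) : ℕ) : ℝ) * φ)‖
        ≤ 2 * ∑' j, e (j + (K + 1)) := by
      rw [← tsum_mul_left]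
      refine tsum_of_norm_bounded (hs.mul_left 2).hasSum fun j => ?_
      rw [Real.norm_eq_abs, abs_mul, abs_mul, abs_two]
      have h1 : |a (j + (K + 1))| ≤ e (j + (K + 1)) := Complex.abs_re_le_norm _
      have h2 := Real.abs_cos_le_one (2 * ((j + (K + 1) : ℕ) : ℝ) * φ)
      have h3 := he0 (j + (K + 1))
      calc 2 * |a (j + (K + 1))| * |Real.cos (2 * ((j + (K + 1) : ℕ) : ℝ) * φ)|
          ≤ 2 * e (j + (K + 1)) * 1 := by gcongr
        _ = _ := mul_one _
    rw [htail.tsum_eq] at hb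
    rw [heval, abs_sub_comm]
    have hd := decay_of_recurrence hα₀ hα he0 hrec (k := K + 1) (by omega)
    have hK0 : (0 : ℝ) < K := by exact_mod_cast hK
    have hmono : ((K + 1 : ℕ) : ℝ) ^ (-(2 * α)) ≤ (K : ℝ) ^ (-(2 * α)) :=
      Real.rpow_le_rpow_of_nonpos hK0 (by push_cast; linarith) (by linarith)
    calc |x ^ α - (∑ k ∈ Finset.range (K + 1), 2 * a k * Real.cos (2 * k * φ) - a 0)|
        = ‖x ^ α + a 0 - ∑ k ∈ Finset.range (K + 1), 2 * a k * Real.cos (2 * k * φ)‖ := by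
          rw [Real.norm_eq_abs]; congr 1; ring
      _ ≤ 2 * ∑' j, e (j + (K + 1)) := hb
      _ ≤ 2 * (((K + 1 : ℕ) + α) * e (K + 1) / (2 * α)) := by gcongr
      _ ≤ 2 * (((2 + α) * e 2 * 2 ^ (2 * α) * (K : ℝ) ^ (-(2 * α))) / (2 * α)) := by
          refine mul_le_mul_of_nonneg_left (div_le_div_of_nonneg_right (hd.trans ?_)
            (by positivity)) zero_le_two
          have := he0 2
          gcongr
      _ = _ := by ring

theorem exists_abs_eval_bestPoly_sub_le {α : ℝ} (hα₀ : 0 < α) (hα : α < 2) :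
    ∃ C : ℝ, 0 ≤ C ∧ ∀ K : ℕ, 1 ≤ K → ∀ x ∈ Set.Icc (0 : ℝ) 1,
      |(bestPoly α K).eval x - x ^ α| ≤ C * (K : ℝ) ^ (-(2 * α)) := by
  obtain ⟨C, hC, h⟩ := exists_polynomial_approx_rpow hα₀ hα
  refine ⟨C, hC, fun K hK x hx => ?_⟩
  obtain ⟨q, hq, hqx⟩ := h K hK
  exact abs_eval_bestPoly_sub_le hα₀ hq hqx hx

/-! ### Poisson thinning -/

open MeasureTheory ProbabilityTheory

theorem map_binomial_singleton (z x y : ℕ) (q : unitInterval) :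
    (binomial z q).map (fun t => (t, z - t)) {(x, y)}
      = if z = x + y then binomial z q {x} else 0 := by
  rw [Measure.map_apply Measurable.of_discrete (MeasurableSet.singleton _)]
  split_ifs with h
  · congr 1
    ext t
    simp only [Set.mem_preimage, Set.mem_singleton_iff, Prod.mk.injEq]
    exact ⟨fun h => h.1, fun h' => ⟨h', by omega⟩⟩
  · rcases lt_or_ge z x with hzx | hzx
    · refine measure_mono_null (t := {x}) (fun t ht => ?_) ?_
      · simp only [Set.mem_preimage, Set.mem_singleton_iff, Prod.mk.injEq] at ht
        exact ht.1
      · rw [binomial_singleton, Nat.choose_eq_zero_of_lt hzx]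
        simp
    · convert measure_empty (μ := binomial z q)
      ext t
      simp only [Set.mem_preimage, Set.mem_singleton_iff, Prod.mk.injEq, Set.mem_empty_iff_false,
        iff_false]
      omega

theorem splitLaw_eq_prod (lam : ℝ≥0) :
    splitLaw lam = (poissonMeasure (lam / 2)).prod (poissonMeasure (lam / 2)) := by
  rw [Measure.ext_iff_singleton]
  rintro ⟨x, y⟩
  rw [splitLaw, Measure.bind_apply (MeasurableSet.singleton _) Measurable.of_discrete.aemeasurable,
    lintegral_countable', ← Set.singleton_prod_singleton, Measure.prod_prod]
  simp_rw [Set.singleton_prod_singleton, map_binomial_singleton]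
  rw [tsum_eq_single (x + y) (fun z hz => by rw [if_neg hz, zero_mul])]
  rw [if_pos rfl, binomial_singleton, poissonMeasure_singleton, poissonMeasure_singleton,
    poissonMeasure_singleton, ← ENNReal.ofReal_mul binomial_nonneg, ← ENNReal.ofReal_mul (by positivity)]
  congr 1
  rw [Nat.cast_add_choose]
  have h2 : Real.exp (-((lam / 2 : ℝ≥0) : ℝ)) * Real.exp (-((lam / 2 : ℝ≥0) : ℝ))
      = Real.exp (-(lam : ℝ)) := by
    rw [← Real.exp_add]; congr 1; push_cast; ring
  have hxy : ((x + y).factorial : ℝ) ≠ 0 := by positivity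
  rw [Nat.add_sub_cancel_left]
  push_cast at h2 ⊢
  rw [← h2]
  norm_num
  field_simp
  simp only [div_pow, one_pow, pow_add]
  ring

/-! ### Moments and tails of the Poisson law -/

section Moments

variable (r : ℝ≥0)

theorem integrable_pow_poisson (a : ℝ) : Integrable (fun n : ℕ => a ^ n) (poissonMeasure r) := by
  rw [integrable_poissonMeasure_iff]
  have := (Real.summable_pow_div_factorial (r * |a|)).mul_left (Real.exp (-r))
  refine this.congr fun n => ?_
  rw [mul_pow, norm_pow, Real.norm_eq_abs]
  ring

theorem integral_pow_poisson (a : ℝ) :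
    ∫ n : ℕ, a ^ n ∂poissonMeasure r = Real.exp (r * (a - 1)) := by
  rw [integral_poissonMeasure]
  have h := (NormedSpace.expSeries_div_hasSum_exp (r * a : ℝ)).mul_left (Real.exp (-r))
  rw [← Real.exp_eq_exp_ℝ, ← Real.exp_add] at h
  rw [show (r : ℝ) * (a - 1) = -r + r * a by ring, ← h.tsum_eq]
  refine tsum_congr fun n => ?_
  rw [smul_eq_mul, mul_pow]
  ring

theorem integrable_poisson_of_le {f : ℕ → ℝ} (C a : ℝ) (h : ∀ n, |f n| ≤ C * a ^ n) :
    Integrable f (poissonMeasure r) :=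
  ((integrable_pow_poisson r a).const_mul C).mono' Measurable.of_discrete.aestronglyMeasurable
    (ae_of_all _ h)

/-- Cancelling `(n)_k` against `n!` shifts the Poisson series by `k`; the terms with `n < k` vanish.
-/
theorem integral_descFactorial_mul (k : ℕ) (f : ℕ → ℝ) :
    ∫ n : ℕ, (n.descFactorial k : ℝ) * f n ∂poissonMeasure r
      = r ^ k * ∫ n : ℕ, f (n + k) ∂poissonMeasure r := by
  rw [integral_poissonMeasure, integral_poissonMeasure, ← tsum_mul_left,
    ← (add_left_injective k).tsum_eq]
  · refine tsum_congr fun n => ?_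
    have h := Nat.factorial_mul_descFactorial (Nat.le_add_left k n)
    rw [Nat.add_sub_cancel] at h
    have h' : (n.factorial : ℝ) * ((n + k).descFactorial k : ℝ) = (n + k).factorial := by
      exact_mod_cast h
    have hd : ((n + k).descFactorial k : ℝ) ≠ 0 := by
      intro h0
      rw [h0, mul_zero] at h'
      exact (Nat.factorial_ne_zero (n + k)) (by exact_mod_cast h'.symm)
    simp only [smul_eq_mul]
    rw [← h', pow_add]
    field_simp
  · intro n hn
    by_contra hr
    apply hn
    have : n < k := by
      by_contra hnk
      exact hr ⟨n - k, by simp only; omega⟩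
    simp [Nat.descFactorial_of_lt this]

theorem integral_descFactorial (k : ℕ) :
    ∫ n : ℕ, (n.descFactorial k : ℝ) ∂poissonMeasure r = r ^ k := by
  simpa using integral_descFactorial_mul r k fun _ => 1

theorem descFactorial_le_mul_two_pow (n k : ℕ) :
    (n.descFactorial k : ℝ) ≤ k.factorial * 2 ^ n := by
  rw [Nat.descFactorial_eq_factorial_mul_choose]
  exact_mod_cast Nat.mul_le_mul_left _ (Nat.choose_le_two_pow n k)

theorem integrable_descFactorial (k : ℕ) :
    Integrable (fun n : ℕ => (n.descFactorial k : ℝ)) (poissonMeasure r) :=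
  integrable_poisson_of_le r k.factorial 2 fun n => by
    rw [abs_of_nonneg (by positivity)]
    exact descFactorial_le_mul_two_pow n k

theorem integrable_descFactorial_sq (k : ℕ) :
    Integrable (fun n : ℕ => (n.descFactorial k : ℝ) ^ 2) (poissonMeasure r) :=
  integrable_poisson_of_le r (k.factorial ^ 2) 4 fun n => by
    rw [abs_of_nonneg (by positivity)]
    calc (n.descFactorial k : ℝ) ^ 2 ≤ (k.factorial * 2 ^ n) ^ 2 := by
          gcongr; exact descFactorial_le_mul_two_pow n k
      _ = _ := by rw [mul_pow, ← pow_mul, mul_comm n 2, pow_mul]; norm_num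

/-- The shift identity turns the square into `r^k E (N+k)_k`. The falling factorial is then
dominated by an exponential in `N`, whose mean is explicit. -/
theorem integral_descFactorial_sq_le {M : ℝ} (hM : 0 < M) (hr : r ≤ M) {k : ℕ} (hk : k ≤ M) :
    ∫ n : ℕ, (n.descFactorial k : ℝ) ^ 2 ∂poissonMeasure r
      ≤ M ^ (2 * k) * Real.exp (2 * k ^ 2 / M) := by
  have h1 : ∫ n : ℕ, (n.descFactorial k : ℝ) ^ 2 ∂poissonMeasure r
      = r ^ k * ∫ n : ℕ, ((n + k).descFactorial k : ℝ) ∂poissonMeasure r := by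
    simp_rw [sq]
    exact integral_descFactorial_mul r k fun n => (n.descFactorial k : ℝ)
  have hpt : ∀ n : ℕ, ((n + k).descFactorial k : ℝ)
      ≤ M ^ k * Real.exp (k ^ 2 / M - k) * Real.exp (k / M) ^ n := by
    intro n
    have h2 : ((n + k).descFactorial k : ℝ) ≤ ((n + k : ℕ) : ℝ) ^ k := by
      exact_mod_cast Nat.descFactorial_le_pow _ _
    -- The bound is tight at `n + k = M`, so little is lost near the top of the allowed range of
    -- means.
    have h3 : ((n + k : ℕ) : ℝ) ≤ M * Real.exp ((n + k : ℕ) / M - 1) := by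
      have := Real.add_one_le_exp (((n + k : ℕ) : ℝ) / M - 1)
      rw [sub_add_cancel, div_le_iff₀ hM] at this
      linarith
    calc ((n + k).descFactorial k : ℝ) ≤ ((n + k : ℕ) : ℝ) ^ k := h2
      _ ≤ (M * Real.exp ((n + k : ℕ) / M - 1)) ^ k := by gcongr
      _ = _ := by
        rw [mul_pow, mul_assoc, ← Real.exp_nat_mul, ← Real.exp_nat_mul, ← Real.exp_add]
        congr 2
        push_cast
        field_simp
        ring
  have h4 : ∫ n : ℕ, ((n + k).descFactorial k : ℝ) ∂poissonMeasure r
      ≤ M ^ k * Real.exp (k ^ 2 / M - k) * Real.exp (r * (Real.exp (k / M) - 1)) := by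
    rw [← integral_pow_poisson, ← integral_const_mul]
    exact integral_mono_of_nonneg (ae_of_all _ fun n => by positivity)
      ((integrable_pow_poisson r _).const_mul _) (ae_of_all _ hpt)
  have hx0 : 0 ≤ (k : ℝ) / M := by positivity
  have hx1 : (k : ℝ) / M ≤ 1 := (div_le_one hM).2 hk
  have h5 : Real.exp (k / M) - 1 ≤ k / M + (k / M) ^ 2 := by
    have := Real.abs_exp_sub_one_sub_id_le (x := k / M) (by rwa [abs_of_nonneg hx0])
    linarith [(abs_le.1 this).2]
  have h6 : (r : ℝ) * (Real.exp (k / M) - 1) ≤ k + k ^ 2 / M := by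
    calc (r : ℝ) * (Real.exp (k / M) - 1) ≤ M * (k / M + (k / M) ^ 2) := by
          gcongr
          linarith [Real.add_one_le_exp ((k : ℝ) / M)]
      _ = _ := by field_simp
  rw [h1]
  calc (r : ℝ) ^ k * ∫ n : ℕ, ((n + k).descFactorial k : ℝ) ∂poissonMeasure r
      ≤ M ^ k * (M ^ k * Real.exp (k ^ 2 / M - k) * Real.exp (k + k ^ 2 / M)) := by
        gcongr
        exact h4.trans (by gcongr)
    _ = _ := by
        rw [mul_assoc (M ^ k), ← Real.exp_add, ← mul_assoc, ← pow_add]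
        congr 1
        · ring
        · congr 1; ring

theorem integrable_cast_poisson : Integrable (fun n : ℕ => (n : ℝ)) (poissonMeasure r) := by
  simpa using integrable_descFactorial r 1

theorem integral_cast_poisson : ∫ n : ℕ, (n : ℝ) ∂poissonMeasure r = r := by
  simpa using integral_descFactorial r 1

theorem cast_sq_eq (n : ℕ) : (n : ℝ) ^ 2 = (n.descFactorial 2 : ℝ) + n := by
  rcases n with _ | n
  · simp
  · simp [Nat.descFactorial_succ]; ring

theorem integrable_sq_poisson : Integrable (fun n : ℕ => (n : ℝ) ^ 2) (poissonMeasure r) := by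
  simp_rw [cast_sq_eq]
  exact (integrable_descFactorial r 2).add (integrable_cast_poisson r)

theorem integral_sq_poisson : ∫ n : ℕ, (n : ℝ) ^ 2 ∂poissonMeasure r = r ^ 2 + r := by
  simp_rw [cast_sq_eq]
  rw [integral_add (integrable_descFactorial r 2) (integrable_cast_poisson r),
    integral_descFactorial, integral_cast_poisson]

theorem integrable_sub_sq_poisson (b : ℝ) :
    Integrable (fun n : ℕ => ((n : ℝ) - b) ^ 2) (poissonMeasure r) := by
  have h : (fun n : ℕ => ((n : ℝ) - b) ^ 2) = fun n : ℕ => (n : ℝ) ^ 2 - 2 * b * n + b ^ 2 := by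
    funext n; ring
  rw [h]
  exact ((integrable_sq_poisson r).sub ((integrable_cast_poisson r).const_mul _)).add
    (integrable_const _)

theorem integral_sub_sq_poisson :
    ∫ n : ℕ, ((n : ℝ) - r) ^ 2 ∂poissonMeasure r = r := by
  have h : (fun n : ℕ => ((n : ℝ) - r) ^ 2)
      = fun n : ℕ => (n : ℝ) ^ 2 - 2 * r * n + (r : ℝ) ^ 2 := by
    funext n; ring
  have hi : Integrable (fun n : ℕ => (n : ℝ) ^ 2 - 2 * r * n) (poissonMeasure r) :=
    (integrable_sq_poisson r).sub ((integrable_cast_poisson r).const_mul _)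
  rw [h, integral_add hi (integrable_const _), integral_sub (integrable_sq_poisson r)
    ((integrable_cast_poisson r).const_mul _), integral_const_mul, integral_sq_poisson,
    integral_cast_poisson]
  simp
  ring

theorem integrable_abs_sub_poisson (b : ℝ) :
    Integrable (fun n : ℕ => |(n : ℝ) - b|) (poissonMeasure r) :=
  ((integrable_cast_poisson r).sub (integrable_const b)).abs

theorem integral_abs_sub_poisson_le :
    ∫ n : ℕ, |(n : ℝ) - r| ∂poissonMeasure r ≤ Real.sqrt r := by
  rcases eq_or_ne r 0 with rfl | hr
  · have h := integral_cast_poisson 0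
    simp only [NNReal.coe_zero, sub_zero, Nat.abs_cast, Real.sqrt_zero] at h ⊢
    exact h.le
  · have hs : 0 < Real.sqrt r := Real.sqrt_pos.2 (by positivity)
    have hsq : Real.sqrt r * Real.sqrt r = r := Real.mul_self_sqrt r.2
    have hpt : ∀ n : ℕ, |(n : ℝ) - r|
        ≤ Real.sqrt r / 2 + (2 * Real.sqrt r)⁻¹ * ((n : ℝ) - r) ^ 2 := by
      intro n
      rw [← sq_abs ((n : ℝ) - r), ← sub_nonneg]
      have : Real.sqrt r / 2 + (2 * Real.sqrt r)⁻¹ * |(n : ℝ) - r| ^ 2 - |(n : ℝ) - r|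
          = (|(n : ℝ) - r| - Real.sqrt r) ^ 2 * (2 * Real.sqrt r)⁻¹ := by
        field_simp
        ring
      rw [this]
      positivity
    have hi := (integrable_sub_sq_poisson r r).const_mul (2 * Real.sqrt r)⁻¹
    have hc : Integrable (fun _ : ℕ => Real.sqrt r / 2) (poissonMeasure r) :=
      integrable_const _
    have hci : Integrable (fun n : ℕ => Real.sqrt r / 2 + (2 * Real.sqrt r)⁻¹ * ((n : ℝ) - r) ^ 2)
        (poissonMeasure r) := hc.add hi
    calc ∫ n : ℕ, |(n : ℝ) - r| ∂poissonMeasure r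
        ≤ ∫ n : ℕ, (Real.sqrt r / 2 + (2 * Real.sqrt r)⁻¹ * ((n : ℝ) - r) ^ 2)
            ∂poissonMeasure r :=
          integral_mono (integrable_abs_sub_poisson r _) hci hpt
      _ = Real.sqrt r := by
          have h1 := integral_add hc hi
          rw [integral_const_mul, integral_sub_sq_poisson, integral_const, probReal_univ,
            one_smul] at h1
          refine h1.trans ?_
          rw [← mul_right_inj' hs.ne', hsq]
          field_simp
          linarith

/-- Markov's inequality for `2^N`; the lower tail below uses `2^(-N)`. -/
theorem integral_indicator_gt_poisson_le (a : ℝ) :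
    ∫ n : ℕ, (if (n : ℝ) ≤ a then 0 else 1 : ℝ) ∂poissonMeasure r
      ≤ Real.exp (r - a * Real.log 2) := by
  have hpt : ∀ n : ℕ, (if (n : ℝ) ≤ a then 0 else 1 : ℝ)
      ≤ Real.exp (-(a * Real.log 2)) * 2 ^ n := by
    intro n
    have h2 : (2 : ℝ) ^ n = Real.exp (n * Real.log 2) := by
      rw [Real.exp_nat_mul, Real.exp_log two_pos]
    split_ifs with h
    · positivity
    · rw [h2, ← Real.exp_add]
      refine Real.one_le_exp ?_
      have := Real.log_pos one_lt_two
      push Not at h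
      nlinarith
  calc _ ≤ ∫ n : ℕ, Real.exp (-(a * Real.log 2)) * 2 ^ n ∂poissonMeasure r :=
        integral_mono_of_nonneg (ae_of_all _ fun n => by simp only [Pi.zero_apply]; positivity)
          ((integrable_pow_poisson r 2).const_mul _) (ae_of_all _ hpt)
    _ = _ := by
        rw [integral_const_mul, integral_pow_poisson, ← Real.exp_add]
        congr 1; ring

theorem integral_indicator_le_poisson_le (a : ℝ) :
    ∫ n : ℕ, (if (n : ℝ) ≤ a then 1 else 0 : ℝ) ∂poissonMeasure r
      ≤ Real.exp (a * Real.log 2 - r / 2) := by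
  have hpt : ∀ n : ℕ, (if (n : ℝ) ≤ a then 1 else 0 : ℝ)
      ≤ Real.exp (a * Real.log 2) * (1 / 2) ^ n := by
    intro n
    have h2 : (1 / 2 : ℝ) ^ n = Real.exp (-(n * Real.log 2)) := by
      rw [Real.exp_neg, Real.exp_nat_mul, Real.exp_log two_pos, one_div, inv_pow]
    split_ifs with h
    · rw [h2, ← Real.exp_add]
      refine Real.one_le_exp ?_
      have := Real.log_pos one_lt_two
      nlinarith
    · positivity
  calc _ ≤ ∫ n : ℕ, Real.exp (a * Real.log 2) * (1 / 2) ^ n ∂poissonMeasure r :=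
        integral_mono_of_nonneg (ae_of_all _ fun n => by simp only [Pi.zero_apply]; positivity)
          ((integrable_pow_poisson r _).const_mul _) (ae_of_all _ hpt)
    _ = _ := by
        rw [integral_const_mul, integral_pow_poisson, ← Real.exp_add]
        congr 1; ring

end Moments

/-! ### Bias and second moment of the polynomial estimator -/

/-- The polynomial `∑_{k=1}^K g_k (x)_k / M ^ k` in falling factorials. -/
noncomputable def factorialPoly (α : ℝ) (K : ℕ) (M : ℝ) (x : ℕ) : ℝ :=
  ∑ k ∈ Finset.Icc 1 K, (bestPoly α K).coeff k * ((x.descFactorial k : ℝ) / M ^ k)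

theorem prod_sub_div_eq (x k : ℕ) (m : ℝ) :
    ∏ r ∈ Finset.range k, ((x : ℝ) / m - (r : ℝ) / m) = (x.descFactorial k : ℝ) / m ^ k := by
  rw [← descPochhammer_eval_eq_descFactorial ℝ, descPochhammer_eval_eq_prod_range]
  simp_rw [← sub_div]
  rw [Finset.prod_div_distrib]
  simp

theorem lowerPoly_eq {α c₁ c₂ m : ℝ} (hm : 0 < m) (hΔ : 0 < Delta c₁ m) (x : ℕ) :
    lowerPoly α c₁ c₂ m ((x : ℝ) / m)
      = (4 * Delta c₁ m) ^ α * factorialPoly α (order c₂ m) (4 * (c₁ * Real.log m)) x := by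
  have hM : 4 * (c₁ * Real.log m) = 4 * Delta c₁ m * m := by
    rw [Delta]; field_simp
  rw [lowerPoly, factorialPoly, Finset.mul_sum]
  refine Finset.sum_congr rfl fun k _ => ?_
  rw [prod_sub_div_eq, Real.rpow_add (by positivity), Real.rpow_neg (by positivity),
    Real.rpow_natCast, hM, mul_pow]
  field_simp
  rw [mul_pow, mul_pow]
  ring

section FactorialPoly

variable (α : ℝ) (K : ℕ) (M : ℝ) (r : ℝ≥0)

theorem integrable_factorialPoly :
    Integrable (factorialPoly α K M) (poissonMeasure r) := by
  unfold factorialPoly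
  exact integrable_finsetSum _ fun k _ => ((integrable_descFactorial r k).div_const _).const_mul _

theorem integral_factorialPoly :
    ∫ x, factorialPoly α K M x ∂poissonMeasure r
      = ∑ k ∈ Finset.Icc 1 K, (bestPoly α K).coeff k * ((r : ℝ) / M) ^ k := by
  unfold factorialPoly
  rw [integral_finsetSum _ fun k _ => ((integrable_descFactorial r k).div_const _).const_mul _]
  refine Finset.sum_congr rfl fun k _ => ?_
  rw [integral_const_mul, integral_div, integral_descFactorial, div_pow]

variable {α K M r}

theorem range_succ_eq_insert (K : ℕ) :
    Finset.range (K + 1) = insert 0 (Finset.Icc 1 K) := by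
  ext k
  simp only [Finset.mem_range, Finset.mem_insert, Finset.mem_Icc]
  omega

theorem sum_Icc_abs_coeff_bestPoly_le (hα : 0 < α) :
    ∑ k ∈ Finset.Icc 1 K, |(bestPoly α K).coeff k| ≤ 2 * 6 ^ K := by
  refine le_trans ?_ (sum_abs_coeff_bestPoly_le hα K)
  refine Finset.sum_le_sum_of_subset_of_nonneg ?_ fun _ _ _ => abs_nonneg _
  rw [range_succ_eq_insert]
  exact Finset.subset_insert _ _

/-- The expectation is the best polynomial at `r/M` without its constant term. That term is itself
at most `E`, being the approximation error at 0, whence the factor 2. -/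
theorem abs_integral_factorialPoly_sub_le (hα : 0 < α) (hM : 0 < M) (hr : r ≤ M) {E : ℝ}
    (hE : ∀ x ∈ Set.Icc (0 : ℝ) 1, |(bestPoly α K).eval x - x ^ α| ≤ E) :
    |∫ x, factorialPoly α K M x ∂poissonMeasure r - ((r : ℝ) / M) ^ α| ≤ 2 * E := by
  have hx : (r : ℝ) / M ∈ Set.Icc (0 : ℝ) 1 :=
    ⟨div_nonneg r.2 hM.le, (div_le_one hM).2 hr⟩
  have h1 := hE _ hx
  have h0 := hE 0 ⟨le_rfl, zero_le_one⟩
  rw [Real.zero_rpow hα.ne', sub_zero] at h0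
  have heval : (bestPoly α K).eval ((r : ℝ) / M) = (bestPoly α K).eval 0
      + ∑ k ∈ Finset.Icc 1 K, (bestPoly α K).coeff k * ((r : ℝ) / M) ^ k := by
    rw [Polynomial.eval_eq_sum_range' (Nat.lt_succ_of_le (isBestApprox_bestPoly hα K).1),
      range_succ_eq_insert, Finset.sum_insert (by simp), pow_zero, mul_one,
      Polynomial.coeff_zero_eq_eval_zero]
  rw [integral_factorialPoly]
  rw [heval] at h1
  rw [abs_le] at h0 h1 ⊢
  constructor <;> linarith [h0.1, h0.2, h1.1, h1.2]

/-- Cauchy–Schwarz with weights `|g_k|`. -/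
theorem factorialPoly_sq_le (hα : 0 < α) (hM : 0 < M) (x : ℕ) :
    factorialPoly α K M x ^ 2 ≤ 2 * 6 ^ K * ∑ k ∈ Finset.Icc 1 K,
      |(bestPoly α K).coeff k| * (((x.descFactorial k : ℝ)) ^ 2 / M ^ (2 * k)) := by
  have h := Finset.sum_sq_le_sum_mul_sum_of_sq_le_mul (Finset.Icc 1 K)
    (r := fun k => (bestPoly α K).coeff k * ((x.descFactorial k : ℝ) / M ^ k))
    (f := fun k => |(bestPoly α K).coeff k|)
    (g := fun k => |(bestPoly α K).coeff k| * (((x.descFactorial k : ℝ)) ^ 2 / M ^ (2 * k)))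
    (fun _ _ => abs_nonneg _) (fun _ _ => by positivity) (fun k _ => le_of_eq (by
      rw [mul_pow, div_pow, ← pow_mul, mul_comm k 2, ← mul_assoc, ← sq, sq_abs]))
  refine h.trans ?_
  gcongr
  exact sum_Icc_abs_coeff_bestPoly_le hα

theorem integrable_factorialPoly_sq (hα : 0 < α) (hM : 0 < M) :
    Integrable (fun x => factorialPoly α K M x ^ 2) (poissonMeasure r) := by
  have h : Integrable (fun x : ℕ => 2 * 6 ^ K * ∑ k ∈ Finset.Icc 1 K,
      |(bestPoly α K).coeff k| * (((x.descFactorial k : ℝ)) ^ 2 / M ^ (2 * k)))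
      (poissonMeasure r) :=
    (integrable_finsetSum _ fun k _ =>
      ((integrable_descFactorial_sq r k).div_const _).const_mul _).const_mul _
  refine h.mono' Measurable.of_discrete.aestronglyMeasurable (ae_of_all _ fun x => ?_)
  rw [Real.norm_of_nonneg (sq_nonneg _)]
  exact factorialPoly_sq_le hα hM x

/-- Two factors `6^K` come from the coefficients. The moment factor is `exp(2k²/M) ≤ e^(K/2) ≤ 2^K`
because `4K ≤ M`, and `6·6·2 = 72 ≤ 2^10`. -/
theorem integral_factorialPoly_sq_le (hα : 0 < α) (hM : 0 < M) (hr : r ≤ M) (hK : 4 * K ≤ M) :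
    ∫ x, factorialPoly α K M x ^ 2 ∂poissonMeasure r ≤ 4 * 2 ^ (10 * K) := by
  have hi : ∀ k, Integrable (fun x : ℕ => |(bestPoly α K).coeff k| *
      (((x.descFactorial k : ℝ)) ^ 2 / M ^ (2 * k))) (poissonMeasure r) :=
    fun k => ((integrable_descFactorial_sq r k).div_const _).const_mul _
  have hexp : Real.exp (K / 2) ≤ 2 ^ K := by
    have h2 : Real.exp (1 / 2) ≤ 2 := by
      rw [← Real.le_log_iff_exp_le two_pos]
      linarith [Real.log_two_gt_d9]
    calc Real.exp (K / 2) = Real.exp (1 / 2) ^ K := by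
          rw [← Real.exp_nat_mul]; congr 1; ring
      _ ≤ 2 ^ K := by gcongr
  calc ∫ x, factorialPoly α K M x ^ 2 ∂poissonMeasure r
      ≤ ∫ x : ℕ, 2 * 6 ^ K * ∑ k ∈ Finset.Icc 1 K,
        |(bestPoly α K).coeff k| * (((x.descFactorial k : ℝ)) ^ 2 / M ^ (2 * k))
          ∂poissonMeasure r :=
        integral_mono (integrable_factorialPoly_sq hα hM)
          ((integrable_finsetSum _ fun k _ => hi k).const_mul _)
          (fun x => factorialPoly_sq_le hα hM x)
    _ = 2 * 6 ^ K * ∑ k ∈ Finset.Icc 1 K, |(bestPoly α K).coeff k| *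
        ((∫ x : ℕ, ((x.descFactorial k : ℝ)) ^ 2 ∂poissonMeasure r) / M ^ (2 * k)) := by
        rw [integral_const_mul, integral_finsetSum _ fun k _ => hi k]
        simp_rw [integral_const_mul, integral_div]
    _ ≤ 2 * 6 ^ K * ∑ k ∈ Finset.Icc 1 K, |(bestPoly α K).coeff k| * 2 ^ K := by
        gcongr with k hk
        have hkK : (k : ℝ) ≤ K := by exact_mod_cast (Finset.mem_Icc.1 hk).2
        have hk0 : (0 : ℝ) ≤ k := by positivity
        rw [div_le_iff₀ (by positivity), mul_comm]
        refine (integral_descFactorial_sq_le r hM hr (by linarith)).trans ?_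
        gcongr
        refine le_trans (Real.exp_le_exp.2 ?_) hexp
        rw [div_le_iff₀ hM]
        nlinarith
    _ ≤ 2 * 6 ^ K * ((2 * 6 ^ K) * 2 ^ K) := by
        rw [← Finset.sum_mul]
        gcongr
        exact sum_Icc_abs_coeff_bestPoly_le hα
    _ = 4 * 72 ^ K := by
        rw [show (72 : ℝ) = 6 * 6 * 2 by norm_num, mul_pow, mul_pow]; ring
    _ ≤ 4 * 2 ^ (10 * K) := by
        rw [pow_mul]
        gcongr
        norm_num

theorem integral_abs_factorialPoly_le (hα : 0 < α) (hM : 0 < M) (hr : M ≤ r) :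
    ∫ x, |factorialPoly α K M x| ∂poissonMeasure r ≤ 2 * 6 ^ K * ((r : ℝ) / M) ^ K := by
  have hi : ∀ k, Integrable (fun x : ℕ => |(bestPoly α K).coeff k| *
      ((x.descFactorial k : ℝ) / M ^ k)) (poissonMeasure r) :=
    fun k => ((integrable_descFactorial r k).div_const _).const_mul _
  have hu : 1 ≤ (r : ℝ) / M := (one_le_div hM).2 hr
  calc ∫ x, |factorialPoly α K M x| ∂poissonMeasure r
      ≤ ∫ x : ℕ, ∑ k ∈ Finset.Icc 1 K, |(bestPoly α K).coeff k| *
        ((x.descFactorial k : ℝ) / M ^ k) ∂poissonMeasure r := by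
        refine integral_mono (integrable_factorialPoly α K M r).abs
          (integrable_finsetSum _ fun k _ => hi k) fun x => ?_
        refine (Finset.abs_sum_le_sum_abs _ _).trans (le_of_eq ?_)
        refine Finset.sum_congr rfl fun k _ => ?_
        rw [abs_mul, abs_of_nonneg (a := (x.descFactorial k : ℝ) / M ^ k) (by positivity)]
    _ = ∑ k ∈ Finset.Icc 1 K, |(bestPoly α K).coeff k| * ((r : ℝ) / M) ^ k := by
        rw [integral_finsetSum _ fun k _ => hi k]
        refine Finset.sum_congr rfl fun k _ => ?_
        rw [integral_const_mul, integral_div, integral_descFactorial, div_pow]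
    _ ≤ ∑ k ∈ Finset.Icc 1 K, |(bestPoly α K).coeff k| * ((r : ℝ) / M) ^ K := by
        gcongr with k hk
        exact (Finset.mem_Icc.1 hk).2
    _ ≤ _ := by
        rw [← Finset.sum_mul]
        gcongr
        exact sum_Icc_abs_coeff_bestPoly_le hα

end FactorialPoly

/-! ### Pointwise bounds for the plug-in estimator -/

theorem abs_interp_le {t : ℝ} (ht : 0 < t) (x : ℝ) : |interp t x| ≤ 1471 := by
  unfold interp
  split_ifs with h1 h2
  · norm_num
  · unfold smoothStep
    have hu0 : 0 ≤ (x - t) / t := div_nonneg (by linarith) ht.le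
    -- The constant 1471 is the sum of the absolute coefficients of `g`.
    have hu1 : (x - t) / t ≤ 1 := (div_le_one ht).2 (by linarith)
    set u := (x - t) / t
    have hp : ∀ n : ℕ, 0 ≤ u ^ n ∧ u ^ n ≤ 1 := fun n => ⟨by positivity, pow_le_one₀ hu0 hu1⟩
    rw [abs_le]
    constructor <;> linarith [(hp 5).1, (hp 5).2, (hp 6).1, (hp 6).2, (hp 7).1, (hp 7).2,
      (hp 8).1, (hp 8).2, (hp 9).1, (hp 9).2]
  · norm_num

section UpperPart

variable {α c₁ m : ℝ}

theorem abs_bias_correction_le (hα₁ : 1 < α) (hα₂ : α < 3 / 2) {x lam : ℝ} (hlam : 0 < lam)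
    (hx : lam / 4 < m * x) : |α * (1 - α) / (2 * m * x)| ≤ 2 / lam := by
  have hmx : 0 < m * x := by linarith
  rw [abs_div, show 2 * m * x = 2 * (m * x) by ring, abs_of_pos (a := 2 * (m * x)) (by linarith),
    div_le_div_iff₀ (by linarith) hlam, abs_of_neg (by nlinarith)]
  have : -(α * (1 - α)) ≤ 3 / 4 := by nlinarith
  nlinarith

theorem abs_upperPart_le (hα₁ : 1 < α) (hα₂ : α < 3 / 2) (hm : 0 < m)
    (hlam : 2 ≤ c₁ * Real.log m) {x : ℝ} (hx : 0 ≤ x) :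
    |upperPart α c₁ m x| ≤ 3000 * x ^ α := by
  have hΔ : Delta c₁ m * m = c₁ * Real.log m := by rw [Delta]; field_simp
  have hΔ0 : 0 < Delta c₁ m := by rw [Delta]; positivity
  have hxα := Real.rpow_nonneg hx α
  unfold upperPart
  by_cases hxt : x ≤ Delta c₁ m / 4
  · rw [interp, if_pos hxt]
    simp only [zero_mul, abs_zero]
    positivity
  · push Not at hxt
    have h1 := abs_interp_le (t := Delta c₁ m / 4) (by positivity) x
    have h2 := abs_bias_correction_le (m := m) hα₁ hα₂ (x := x) (lam := c₁ * Real.log m)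
      (by linarith) (by rw [← hΔ]; nlinarith)
    have h3 : 2 / (c₁ * Real.log m) ≤ 1 := (div_le_one (by linarith)).2 hlam
    have h4 : |1 + α * (1 - α) / (2 * m * x)| ≤ 2 := by
      refine (abs_add_le _ _).trans ?_
      rw [abs_one]; linarith
    rw [abs_mul, abs_mul, abs_of_nonneg hxα]
    refine mul_le_mul_of_nonneg_right ?_ hxα
    calc _ ≤ 1471 * (2 : ℝ) := by gcongr
      _ ≤ 3000 := by norm_num

theorem abs_rpow_sub_one_le (hα₁ : 1 < α) (hα₂ : α < 3 / 2) {ρ : ℝ} (hρ : 0 ≤ ρ) :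
    |ρ ^ α - 1| ≤ 2 * |ρ - 1| + (ρ - 1) ^ 2 := by
  rcases le_total 1 ρ with h | h
  · have h1 : 1 ≤ ρ ^ α := Real.one_le_rpow h (by linarith)
    have h3 : ρ ^ α ≤ ρ ^ (2 : ℝ) := Real.rpow_le_rpow_of_exponent_le h (by linarith)
    rw [Real.rpow_two] at h3
    rw [abs_of_nonneg (by linarith), abs_of_nonneg (by linarith)]
    nlinarith
  · have h1 : ρ ^ α ≤ 1 := Real.rpow_le_one hρ h (by linarith)
    have h3 : ρ ^ (2 : ℝ) ≤ ρ ^ α :=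
      Real.rpow_le_rpow_of_exponent_ge' hρ h (by linarith) (by linarith)
    rw [Real.rpow_two] at h3
    rw [abs_of_nonpos (by linarith), abs_of_nonpos (by linarith)]
    nlinarith

/-- For `x ≥ Δ/2` the interpolation equals 1 and only `ρ^α - 1`, `ρ = x/p`, and the bias correction
contribute. Below, `ρ ≤ 1/2`, so the quadratic term alone is at least `13000/4` and absorbs the
crude bound 3001. -/
theorem abs_upperPart_sub_le (hα₁ : 1 < α) (hα₂ : α < 3 / 2) (hm : 0 < m)
    (hlam : 2 ≤ c₁ * Real.log m) {p x : ℝ} (hp : Delta c₁ m ≤ p) (hx : 0 ≤ x) :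
    |upperPart α c₁ m x - p ^ α|
      ≤ p ^ α * (2 / (c₁ * Real.log m) + 4 * |x / p - 1| + 13000 * (x / p - 1) ^ 2) := by
  have hΔ : Delta c₁ m * m = c₁ * Real.log m := by rw [Delta]; field_simp
  have hΔ0 : 0 < Delta c₁ m := by rw [Delta]; positivity
  have hp0 : 0 < p := hΔ0.trans_le hp
  set lam := c₁ * Real.log m with hlamdef
  set ρ := x / p with hρ
  have hρ0 : 0 ≤ ρ := div_nonneg hx hp0.le
  have hxρ : x = p * ρ := by rw [hρ]; field_simp
  have hpα : 0 < p ^ α := Real.rpow_pos_of_pos hp0 α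
  have hxα : x ^ α = p ^ α * ρ ^ α := by rw [hxρ, Real.mul_rpow hp0.le hρ0]
  have hθ0 : 0 < 2 / lam := by positivity
  have hθ1 : 2 / lam ≤ 1 := (div_le_one (by linarith)).2 hlam
  by_cases hcase : Delta c₁ m / 2 ≤ x
  · have h2 := abs_bias_correction_le (m := m) hα₁ hα₂ (x := x) (lam := lam)
      (by linarith) (by rw [← hΔ]; nlinarith)
    have hI : interp (Delta c₁ m / 4) x = 1 := by
      rw [interp, if_neg (by linarith), if_neg (by linarith)]
    set κ := α * (1 - α) / (2 * m * x)
    have h3 := abs_rpow_sub_one_le hα₁ hα₂ hρ0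
    have h4 : ρ ^ α ≤ 1 + 2 * |ρ - 1| + (ρ - 1) ^ 2 := by linarith [(abs_le.1 h3).2]
    have heq : upperPart α c₁ m x - p ^ α = p ^ α * ((ρ ^ α - 1) + κ * ρ ^ α) := by
      rw [upperPart, hI, hxα]; ring
    rw [heq, abs_mul, abs_of_pos hpα]
    refine mul_le_mul_of_nonneg_left ?_ hpα.le
    have h5 : |κ * ρ ^ α| ≤ 2 / lam * (1 + 2 * |ρ - 1| + (ρ - 1) ^ 2) := by
      rw [abs_mul, abs_of_nonneg (Real.rpow_nonneg hρ0 α)]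
      gcongr
    have h6 : 2 / lam * (1 + 2 * |ρ - 1| + (ρ - 1) ^ 2)
        ≤ 2 / lam + 2 * |ρ - 1| + (ρ - 1) ^ 2 := by
      have : 0 ≤ 2 * |ρ - 1| + (ρ - 1) ^ 2 := by positivity
      nlinarith
    have := abs_add_le (ρ ^ α - 1) (κ * ρ ^ α)
    nlinarith [sq_nonneg (ρ - 1)]
  · push Not at hcase
    have hρ1 : ρ ≤ 1 / 2 := by
      rw [hρ, div_le_iff₀ hp0]; linarith
    have h1 := abs_upperPart_le (c₁ := c₁) hα₁ hα₂ hm hlam hx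
    have h2 : ρ ^ α ≤ 1 := Real.rpow_le_one hρ0 (by linarith) (by linarith)
    have h3 : x ^ α ≤ p ^ α := by rw [hxα]; nlinarith
    have h4 : 1 / 4 ≤ (ρ - 1) ^ 2 := by nlinarith
    have h5 := abs_sub (upperPart α c₁ m x) (p ^ α)
    rw [abs_of_pos hpα] at h5
    have h6 : 3001 ≤ 2 / lam + 4 * |ρ - 1| + 13000 * (ρ - 1) ^ 2 := by
      have := abs_nonneg (ρ - 1)
      linarith
    nlinarith

end UpperPart

/-! ### Error of one symbol: the polynomial branch -/

/-- The contribution of one symbol to the estimator. -/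
noncomputable def symbolEst (α c₁ c₂ m : ℝ) (xy : ℕ × ℕ) : ℝ :=
  if (xy.2 : ℝ) / m ≤ 2 * Delta c₁ m
    then lowerPart α c₁ c₂ m ((xy.1 : ℝ) / m)
    else upperPart α c₁ m ((xy.1 : ℝ) / m)

/-- The error of the polynomial estimator of a symbol of small probability. -/
noncomputable def polyErr (α c₁ c₂ m p : ℝ) (xy : ℕ × ℕ) : ℝ :=
  if p ≤ 4 * Delta c₁ m then
    (lowerPart α c₁ c₂ m ((xy.1 : ℝ) / m) - p ^ α) *
      (if (xy.2 : ℝ) ≤ 2 * (c₁ * Real.log m) then 1 else 0)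
  else 0

/-- The rest of the error of the estimator of one symbol. -/
noncomputable def restErr (α c₁ c₂ m p : ℝ) (xy : ℕ × ℕ) : ℝ :=
  symbolEst α c₁ c₂ m xy - p ^ α - polyErr α c₁ c₂ m p xy

theorem abs_min_one_le (s : ℝ) : |min s 1| ≤ |s| := by
  rcases le_total s 1 with h | h
  · rw [min_eq_left h]
  · rw [min_eq_right h, abs_one]
    exact h.trans (le_abs_self s)

theorem abs_min_one_sub_le (s : ℝ) : |min s 1 - s| ≤ s ^ 2 := by
  rcases le_total s 1 with h | h
  · rw [min_eq_left h, sub_self, abs_zero]; positivity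
  · rw [min_eq_right h, abs_of_nonpos (by linarith)]; nlinarith

theorem rpow_le_add_sq {α t : ℝ} (hα₁ : 1 < α) (hα₂ : α < 3 / 2) (ht : 0 ≤ t) :
    t ^ α ≤ t + t ^ 2 := by
  rcases le_total t 1 with h | h
  · have h1 : t ^ α ≤ t ^ (1 : ℝ) :=
      Real.rpow_le_rpow_of_exponent_ge' ht h zero_le_one hα₁.le
    rw [Real.rpow_one] at h1
    nlinarith
  · have h1 : t ^ α ≤ t ^ (2 : ℝ) := Real.rpow_le_rpow_of_exponent_le h (by linarith)
    rw [Real.rpow_two] at h1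
    linarith

section OneSymbol

variable {α c₁ c₂ m p : ℝ} {r : ℝ≥0}

theorem abs_lowerPart_le (hm : 0 < m) (hΔ : 0 < Delta c₁ m) (x : ℕ) :
    |lowerPart α c₁ c₂ m ((x : ℝ) / m)| ≤ (4 * Delta c₁ m) ^ α *
      |factorialPoly α (order c₂ m) (4 * (c₁ * Real.log m)) x| := by
  refine (abs_min_one_le _).trans (le_of_eq ?_)
  rw [lowerPoly_eq hm hΔ, abs_mul, abs_of_nonneg (by positivity)]

theorem integrable_lowerPart (hm : 0 < m) (hΔ : 0 < Delta c₁ m) :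
    Integrable (fun x : ℕ => lowerPart α c₁ c₂ m ((x : ℝ) / m)) (poissonMeasure r) :=
  ((integrable_factorialPoly α _ _ r).abs.const_mul _).mono'
    Measurable.of_discrete.aestronglyMeasurable (ae_of_all _ fun x => abs_lowerPart_le hm hΔ x)

theorem sq_lowerPart_sub_le (hm : 0 < m) (hΔ : 0 < Delta c₁ m) (hp : 0 ≤ p)
    (hpΔ : p ≤ 4 * Delta c₁ m) (hα : 0 < α) (x : ℕ) :
    (lowerPart α c₁ c₂ m ((x : ℝ) / m) - p ^ α) ^ 2 ≤ ((4 * Delta c₁ m) ^ α) ^ 2 *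
      (2 * factorialPoly α (order c₂ m) (4 * (c₁ * Real.log m)) x ^ 2 + 2) := by
  have h1 := abs_lowerPart_le (α := α) (c₂ := c₂) hm hΔ x
  set L := lowerPart α c₁ c₂ m ((x : ℝ) / m)
  set N := factorialPoly α (order c₂ m) (4 * (c₁ * Real.log m)) x
  set D := (4 * Delta c₁ m) ^ α
  have h2 : p ^ α ≤ D := Real.rpow_le_rpow hp hpΔ hα.le
  have h3 : 0 ≤ p ^ α := Real.rpow_nonneg hp α
  have h4 : L ^ 2 ≤ (D * |N|) ^ 2 := by
    rw [← sq_abs L]; gcongr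
  rw [mul_pow, sq_abs] at h4
  have h5 : (p ^ α) ^ 2 ≤ D ^ 2 := by gcongr
  nlinarith [sq_nonneg (L + p ^ α)]

theorem integral_indicator_le_one (a : ℝ) :
    0 ≤ ∫ n : ℕ, (if (n : ℝ) ≤ a then 1 else 0 : ℝ) ∂poissonMeasure r ∧
    ∫ n : ℕ, (if (n : ℝ) ≤ a then 1 else 0 : ℝ) ∂poissonMeasure r ≤ 1 := by
  constructor
  · exact integral_nonneg fun n => by positivity
  · have h := integral_mono_of_nonneg (μ := poissonMeasure r)
      (f := fun n : ℕ => (if (n : ℝ) ≤ a then 1 else 0 : ℝ)) (g := fun _ => 1)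
      (ae_of_all _ fun n => by simp only [Pi.zero_apply]; positivity) (integrable_const _)
      (ae_of_all _ fun n => by simp only; split_ifs <;> norm_num)
    simpa using h

theorem integral_indicator_gt_le_one (a : ℝ) :
    0 ≤ ∫ n : ℕ, (if (n : ℝ) ≤ a then 0 else 1 : ℝ) ∂poissonMeasure r ∧
    ∫ n : ℕ, (if (n : ℝ) ≤ a then 0 else 1 : ℝ) ∂poissonMeasure r ≤ 1 := by
  constructor
  · exact integral_nonneg fun n => by positivity
  · have h := integral_mono_of_nonneg (μ := poissonMeasure r)
      (f := fun n : ℕ => (if (n : ℝ) ≤ a then 0 else 1 : ℝ)) (g := fun _ => 1)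
      (ae_of_all _ fun n => by simp only [Pi.zero_apply]; positivity) (integrable_const _)
      (ae_of_all _ fun n => by simp only; split_ifs <;> norm_num)
    simpa using h

/-- The first term is the approximation error. The second is the cost of the truncation at 1,
through `|min s 1 - s| ≤ s²` and the second moment. -/
theorem abs_integral_lowerPart_sub_le (hα : 0 < α) (hm : 0 < m) (hlam : 0 < c₁ * Real.log m)
    (hr : (r : ℝ) = m * p) (hpΔ : p ≤ 4 * Delta c₁ m)
    (hK : (order c₂ m : ℝ) ≤ c₁ * Real.log m) {E : ℝ}
    (hE : ∀ x ∈ Set.Icc (0 : ℝ) 1, |(bestPoly α (order c₂ m)).eval x - x ^ α| ≤ E) :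
    |∫ x : ℕ, lowerPart α c₁ c₂ m ((x : ℝ) / m) ∂poissonMeasure r - p ^ α|
      ≤ 2 * E * (4 * Delta c₁ m) ^ α
        + ((4 * Delta c₁ m) ^ α) ^ 2 * (4 * 2 ^ (10 * order c₂ m)) := by
  have hΔ : 0 < Delta c₁ m := div_pos hlam hm
  have hΔm : Delta c₁ m * m = c₁ * Real.log m := by rw [Delta]; field_simp
  set K := order c₂ m
  set M := 4 * (c₁ * Real.log m) with hM
  have hM0 : 0 < M := by positivity
  set D := (4 * Delta c₁ m) ^ α with hD
  have hD0 : 0 < D := by positivity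
  have hrM : (r : ℝ) ≤ M := by rw [hr, hM, ← hΔm]; nlinarith
  have hp : 0 ≤ p := by
    by_contra h
    push Not at h
    have := r.2
    rw [NNReal.val_eq_coe, hr] at this
    nlinarith
  have hpα : p ^ α = D * ((r : ℝ) / M) ^ α := by
    rw [hD, ← Real.mul_rpow (by positivity) (by positivity), hr, hM, ← hΔm]
    congr 1
    field_simp
  have hi := integrable_factorialPoly α K M r
  have hi2 := integrable_factorialPoly_sq (K := K) (M := M) (r := r) hα hM0
  have hL := integrable_lowerPart (α := α) (c₂ := c₂) (r := r) hm hΔ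
  have h1 := abs_integral_factorialPoly_sub_le (K := K) hα hM0 hrM hE
  have h2 := integral_factorialPoly_sq_le (K := K) hα hM0 hrM (by rw [hM]; linarith)
  have h3 : |∫ x : ℕ, lowerPart α c₁ c₂ m ((x : ℝ) / m) ∂poissonMeasure r
      - ∫ x : ℕ, D * factorialPoly α K M x ∂poissonMeasure r| ≤ D ^ 2 * (4 * 2 ^ (10 * K)) := by
    rw [← integral_sub hL (hi.const_mul D)]
    refine abs_integral_le_integral_abs.trans ?_
    calc _ ≤ ∫ x : ℕ, D ^ 2 * factorialPoly α K M x ^ 2 ∂poissonMeasure r := by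
          refine integral_mono (hL.sub (hi.const_mul D)).abs (hi2.const_mul _) fun x => ?_
          simp only
          rw [lowerPart, lowerPoly_eq hm hΔ, ← mul_pow]
          exact abs_min_one_sub_le _
      _ ≤ _ := by
          rw [integral_const_mul]
          gcongr
  rw [integral_const_mul] at h3
  have h4 : |D * ∫ x : ℕ, factorialPoly α K M x ∂poissonMeasure r - p ^ α| ≤ 2 * E * D := by
    rw [hpα, ← mul_sub, abs_mul, abs_of_pos hD0, mul_comm]
    gcongr
  have := abs_add_le (∫ x : ℕ, lowerPart α c₁ c₂ m ((x : ℝ) / m) ∂poissonMeasure r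
    - D * ∫ x : ℕ, factorialPoly α K M x ∂poissonMeasure r)
    (D * ∫ x : ℕ, factorialPoly α K M x ∂poissonMeasure r - p ^ α)
  rw [sub_add_sub_cancel] at this
  linarith

theorem abs_integral_polyErr_le (hα : 0 < α) (hm : 0 < m) (hlam : 0 < c₁ * Real.log m)
    (hr : (r : ℝ) = m * p) (hK : (order c₂ m : ℝ) ≤ c₁ * Real.log m) {E : ℝ}
    (hE : ∀ x ∈ Set.Icc (0 : ℝ) 1, |(bestPoly α (order c₂ m)).eval x - x ^ α| ≤ E) :
    |∫ xy, polyErr α c₁ c₂ m p xy ∂(poissonMeasure r).prod (poissonMeasure r)|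
      ≤ 2 * E * (4 * Delta c₁ m) ^ α
        + ((4 * Delta c₁ m) ^ α) ^ 2 * (4 * 2 ^ (10 * order c₂ m)) := by
  have hΔ : 0 < Delta c₁ m := div_pos hlam hm
  have hE0 : 0 ≤ E := (abs_nonneg _).trans (hE 0 ⟨le_rfl, zero_le_one⟩)
  unfold polyErr
  split_ifs with hpΔ
  · have hL := integrable_lowerPart (α := α) (c₂ := c₂) (r := r) hm hΔ
    rw [integral_prod_mul (fun x : ℕ => lowerPart α c₁ c₂ m ((x : ℝ) / m) - p ^ α)
      (fun y : ℕ => if (y : ℝ) ≤ 2 * (c₁ * Real.log m) then (1 : ℝ) else 0),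
      integral_sub hL (integrable_const _), integral_const, probReal_univ, one_smul, abs_mul]
    have h1 := integral_indicator_le_one (r := r) (2 * (c₁ * Real.log m))
    rw [abs_of_nonneg h1.1]
    refine (mul_le_of_le_one_right (abs_nonneg _) h1.2).trans ?_
    exact abs_integral_lowerPart_sub_le hα hm hlam hr hpΔ hK hE
  · simp only [integral_zero, abs_zero]
    positivity

theorem polyErr_sq_le (hα : 0 < α) (hm : 0 < m) (hlam : 0 < c₁ * Real.log m) (hp : 0 ≤ p)
    (xy : ℕ × ℕ) : polyErr α c₁ c₂ m p xy ^ 2 ≤ ((4 * Delta c₁ m) ^ α) ^ 2 *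
      (2 * factorialPoly α (order c₂ m) (4 * (c₁ * Real.log m)) xy.1 ^ 2 + 2) := by
  have hΔ : 0 < Delta c₁ m := div_pos hlam hm
  unfold polyErr
  split_ifs with hpΔ h
  · rw [mul_one]
    exact sq_lowerPart_sub_le hm hΔ hp hpΔ hα xy.1
  · rw [mul_zero, zero_pow two_ne_zero]; positivity
  · rw [zero_pow two_ne_zero]; positivity

theorem integrable_polyErr_bound (hα : 0 < α) (hlam : 0 < c₁ * Real.log m) :
    Integrable (fun xy : ℕ × ℕ => ((4 * Delta c₁ m) ^ α) ^ 2 *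
      (2 * factorialPoly α (order c₂ m) (4 * (c₁ * Real.log m)) xy.1 ^ 2 + 2))
      ((poissonMeasure r).prod (poissonMeasure r)) :=
  Integrable.comp_fst (f := fun x : ℕ => ((4 * Delta c₁ m) ^ α) ^ 2 *
      (2 * factorialPoly α (order c₂ m) (4 * (c₁ * Real.log m)) x ^ 2 + 2))
    ((((integrable_factorialPoly_sq hα (by positivity)).const_mul 2).add
      (integrable_const 2)).const_mul _) _

theorem memLp_polyErr (hα : 0 < α) (hm : 0 < m) (hlam : 0 < c₁ * Real.log m) (hp : 0 ≤ p) :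
    MemLp (polyErr α c₁ c₂ m p) 2 ((poissonMeasure r).prod (poissonMeasure r)) := by
  rw [memLp_two_iff_integrable_sq Measurable.of_discrete.aestronglyMeasurable]
  refine (integrable_polyErr_bound (c₂ := c₂) (r := r) hα hlam).mono'
    Measurable.of_discrete.aestronglyMeasurable (ae_of_all _ fun xy => ?_)
  rw [Real.norm_of_nonneg (sq_nonneg _)]
  exact polyErr_sq_le hα hm hlam hp xy

theorem integral_polyErr_sq_le (hα : 0 < α) (hm : 0 < m) (hlam : 0 < c₁ * Real.log m)
    (hr : (r : ℝ) = m * p) (hp : 0 ≤ p) (hK : (order c₂ m : ℝ) ≤ c₁ * Real.log m) :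
    ∫ xy, polyErr α c₁ c₂ m p xy ^ 2 ∂(poissonMeasure r).prod (poissonMeasure r)
      ≤ ((4 * Delta c₁ m) ^ α) ^ 2 * (10 * 2 ^ (10 * order c₂ m)) := by
  by_cases hpΔ : p ≤ 4 * Delta c₁ m
  · have hΔm : Delta c₁ m * m = c₁ * Real.log m := by rw [Delta]; field_simp
    have hrM : (r : ℝ) ≤ 4 * (c₁ * Real.log m) := by rw [hr, ← hΔm]; nlinarith
    have h2 := integral_factorialPoly_sq_le (K := order c₂ m) hα (by positivity) hrM
      (by linarith)
    have hi2 := integrable_factorialPoly_sq (K := order c₂ m) (M := 4 * (c₁ * Real.log m))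
      (r := r) hα (by positivity)
    have hone : (1 : ℝ) ≤ 2 ^ (10 * order c₂ m) := one_le_pow₀ one_le_two
    calc _ ≤ ∫ xy : ℕ × ℕ, ((4 * Delta c₁ m) ^ α) ^ 2 *
          (2 * factorialPoly α (order c₂ m) (4 * (c₁ * Real.log m)) xy.1 ^ 2 + 2)
            ∂(poissonMeasure r).prod (poissonMeasure r) :=
          integral_mono (memLp_polyErr hα hm hlam hp).integrable_sq
            (integrable_polyErr_bound hα hlam) (polyErr_sq_le hα hm hlam hp)
      _ = ((4 * Delta c₁ m) ^ α) ^ 2 * (2 * ∫ x : ℕ, factorialPoly α (order c₂ m)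
          (4 * (c₁ * Real.log m)) x ^ 2 ∂poissonMeasure r + 2) := by
          rw [integral_fun_fst (fun x : ℕ => ((4 * Delta c₁ m) ^ α) ^ 2 *
            (2 * factorialPoly α (order c₂ m) (4 * (c₁ * Real.log m)) x ^ 2 + 2)),
            probReal_univ, one_smul, integral_const_mul,
            integral_add (hi2.const_mul 2) (integrable_const 2), integral_const_mul,
            integral_const, probReal_univ, one_smul]
      _ ≤ _ := by
          refine mul_le_mul_of_nonneg_left ?_ (sq_nonneg _)
          linarith
  · have : ∀ xy, polyErr α c₁ c₂ m p xy = 0 := fun xy => if_neg hpΔ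
    simp only [this]
    norm_num
    positivity

end OneSymbol

/-! ### Error of one symbol: the plug-in branch and the wrong branches -/

/-- The bound for the absolute value of `restErr` by a sum of two products. -/
noncomputable def restBound (α c₁ c₂ m p : ℝ) (xy : ℕ × ℕ) : ℝ :=
  |upperPart α c₁ m ((xy.1 : ℝ) / m) - p ^ α| *
      (if (xy.2 : ℝ) ≤ 2 * (c₁ * Real.log m) then 0 else 1) +
  (if p ≤ 4 * Delta c₁ m then 0 else (4 * Delta c₁ m) ^ α *
      |factorialPoly α (order c₂ m) (4 * (c₁ * Real.log m)) xy.1| + p ^ α) *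
      (if (xy.2 : ℝ) ≤ 2 * (c₁ * Real.log m) then 1 else 0)

section OneSymbol

variable {α c₁ c₂ m p : ℝ} {r : ℝ≥0}

theorem abs_restErr_le (hm : 0 < m) (hlam : 0 < c₁ * Real.log m) (hp : 0 ≤ p) (xy : ℕ × ℕ) :
    |restErr α c₁ c₂ m p xy| ≤ restBound α c₁ c₂ m p xy := by
  have hΔ : 0 < Delta c₁ m := div_pos hlam hm
  have hΔm : 2 * Delta c₁ m * m = 2 * (c₁ * Real.log m) := by rw [Delta]; field_simp
  have hpα := Real.rpow_nonneg hp α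
  unfold restErr restBound symbolEst polyErr
  simp only [div_le_iff₀ hm, hΔm]
  by_cases hy : (xy.2 : ℝ) ≤ 2 * (c₁ * Real.log m)
  · simp only [if_pos hy, mul_zero, zero_add, mul_one]
    split_ifs with h
    · simp
    · rw [sub_zero]
      have h1 := abs_lowerPart_le (α := α) (c₂ := c₂) hm hΔ xy.1
      have h2 := abs_sub (lowerPart α c₁ c₂ m ((xy.1 : ℝ) / m)) (p ^ α)
      rw [abs_of_nonneg hpα] at h2
      linarith
  · simp only [if_neg hy, mul_zero, mul_one, add_zero, ite_self, sub_zero]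
    exact le_rfl

theorem integrable_upper_bound (hα₁ : 1 < α) (hα₂ : α < 3 / 2) (hm : 0 < m)
    (hlam : 2 ≤ c₁ * Real.log m) :
    Integrable (fun x : ℕ => |upperPart α c₁ m ((x : ℝ) / m) - p ^ α|) (poissonMeasure r) := by
  have h : Integrable (fun x : ℕ => upperPart α c₁ m ((x : ℝ) / m)) (poissonMeasure r) := by
    have h1 : Integrable (fun x : ℕ => 3000 * ((x : ℝ) / m + (x : ℝ) ^ 2 / m ^ 2))
        (poissonMeasure r) :=
      (((integrable_cast_poisson r).div_const m).add
        ((integrable_sq_poisson r).div_const (m ^ 2))).const_mul 3000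
    refine h1.mono' Measurable.of_discrete.aestronglyMeasurable (ae_of_all _ fun x => ?_)
    have hx : 0 ≤ (x : ℝ) / m := by positivity
    refine (abs_upperPart_le hα₁ hα₂ hm hlam hx).trans ?_
    rw [← div_pow]
    gcongr
    exact rpow_le_add_sq hα₁ hα₂ hx
  exact (h.sub (integrable_const _)).abs

/-- The pointwise bound is integrated with `E|N - r| ≤ √r` and `Var N = r`. Since `r ≥ λ`, each of
the three terms is `O(λ^(-1/2))`. -/
theorem integral_abs_upperPart_sub_le (hα₁ : 1 < α) (hα₂ : α < 3 / 2) (hm : 0 < m)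
    (hlam : 2 ≤ c₁ * Real.log m) (hr : (r : ℝ) = m * p) (hp : Delta c₁ m ≤ p) :
    ∫ x : ℕ, |upperPart α c₁ m ((x : ℝ) / m) - p ^ α| ∂poissonMeasure r
      ≤ 13006 / Real.sqrt (c₁ * Real.log m) * p ^ α := by
  have hΔm : Delta c₁ m * m = c₁ * Real.log m := by rw [Delta]; field_simp
  have hΔ0 : 0 < Delta c₁ m := div_pos (by linarith) hm
  have hp0 : 0 < p := hΔ0.trans_le hp
  set lam := c₁ * Real.log m with hlamdef
  have hr0 : (0 : ℝ) < r := by rw [hr]; positivity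
  have hlr : lam ≤ r := by rw [hr, ← hΔm]; nlinarith
  have hpα : 0 ≤ p ^ α := Real.rpow_nonneg hp0.le α
  set s := Real.sqrt lam with hs
  have hs2 : s ^ 2 = lam := Real.sq_sqrt (by linarith)
  have hs1 : 1 ≤ s := Real.one_le_sqrt.2 (by linarith)
  set s' := Real.sqrt r with hs'
  have hs'2 : s' ^ 2 = r := Real.sq_sqrt r.2
  have hss' : s ≤ s' := Real.sqrt_le_sqrt hlr
  have hpt : ∀ x : ℕ, |upperPart α c₁ m ((x : ℝ) / m) - p ^ α|
      ≤ p ^ α * (2 / lam + 4 / r * |(x : ℝ) - r| + 13000 / (r : ℝ) ^ 2 * ((x : ℝ) - r) ^ 2) := by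
    intro x
    refine (abs_upperPart_sub_le hα₁ hα₂ hm hlam hp (x := (x : ℝ) / m) (by positivity)).trans
      (le_of_eq ?_)
    have h : (x : ℝ) / m / p - 1 = ((x : ℝ) - r) / r := by
      rw [hr]; field_simp
    rw [h, abs_div, abs_of_pos hr0, div_pow, ← hlamdef]
    ring
  have i0 : Integrable (fun _ : ℕ => 2 / lam) (poissonMeasure r) := integrable_const _
  have i0' : Integrable (fun x : ℕ => 4 / r * |(x : ℝ) - r|) (poissonMeasure r) :=
    (integrable_abs_sub_poisson r r).const_mul _
  have i1 : Integrable (fun x : ℕ => 2 / lam + 4 / r * |(x : ℝ) - r|) (poissonMeasure r) :=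
    i0.add i0'
  have i2 : Integrable (fun x : ℕ => 13000 / (r : ℝ) ^ 2 * ((x : ℝ) - r) ^ 2)
      (poissonMeasure r) := (integrable_sub_sq_poisson r r).const_mul _
  have i3 : Integrable (fun x : ℕ => 2 / lam + 4 / r * |(x : ℝ) - r|
      + 13000 / (r : ℝ) ^ 2 * ((x : ℝ) - r) ^ 2) (poissonMeasure r) := i1.add i2
  have i4 := i3.const_mul (p ^ α)
  calc _ ≤ ∫ x : ℕ, p ^ α * (2 / lam + 4 / r * |(x : ℝ) - r|
          + 13000 / (r : ℝ) ^ 2 * ((x : ℝ) - r) ^ 2) ∂poissonMeasure r :=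
        integral_mono (integrable_upper_bound hα₁ hα₂ hm hlam) i4 hpt
    _ = p ^ α * (2 / lam + 4 / r * ∫ x : ℕ, |(x : ℝ) - r| ∂poissonMeasure r
          + 13000 / (r : ℝ) ^ 2 * r) := by
        rw [integral_const_mul, integral_add i1 i2, integral_add i0 i0', integral_const_mul, integral_const_mul,
          integral_sub_sq_poisson, integral_const, probReal_univ, one_smul]
    _ ≤ p ^ α * (2 / s + 4 / s + 13000 / s) := by
        have e1 : 2 / lam ≤ 2 / s := by
          rw [← hs2]
          gcongr
          nlinarith
        have e2 : 4 / r * ∫ x : ℕ, |(x : ℝ) - r| ∂poissonMeasure r ≤ 4 / s := by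
          calc 4 / r * ∫ x : ℕ, |(x : ℝ) - r| ∂poissonMeasure r ≤ 4 / r * s' := by
                gcongr; exact integral_abs_sub_poisson_le r
            _ = 4 / s' := by rw [← hs'2]; field_simp
            _ ≤ 4 / s := by gcongr
        have e3 : 13000 / (r : ℝ) ^ 2 * r ≤ 13000 / s := by
          calc 13000 / (r : ℝ) ^ 2 * r = 13000 / r := by field_simp
            _ ≤ 13000 / s := by
              gcongr
              nlinarith
        gcongr
    _ = _ := by ring

theorem integral_abs_upperPart_sub_le_of_small (hα₁ : 1 < α) (hα₂ : α < 3 / 2) (hm : 1 ≤ m)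
    (hlam : 2 ≤ c₁ * Real.log m) (hr : (r : ℝ) = m * p) (hp0 : 0 ≤ p) (hp1 : p ≤ 1) :
    ∫ x : ℕ, |upperPart α c₁ m ((x : ℝ) / m) - p ^ α| ∂poissonMeasure r ≤ 9001 * p := by
  have hm0 : 0 < m := by linarith
  have hpα : p ^ α ≤ p := by
    have := Real.rpow_le_rpow_of_exponent_ge' hp0 hp1 zero_le_one hα₁.le
    rwa [Real.rpow_one] at this
  have i1 : Integrable (fun x : ℕ => (x : ℝ) / m) (poissonMeasure r) :=
    (integrable_cast_poisson r).div_const m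
  have i2 : Integrable (fun x : ℕ => (x : ℝ) ^ 2 / m ^ 2) (poissonMeasure r) :=
    (integrable_sq_poisson r).div_const (m ^ 2)
  have i3 : Integrable (fun x : ℕ => 3000 * ((x : ℝ) / m + (x : ℝ) ^ 2 / m ^ 2))
      (poissonMeasure r) := (i1.add i2).const_mul _
  have i4 : Integrable (fun _ : ℕ => p) (poissonMeasure r) := integrable_const _
  have i5 : Integrable (fun x : ℕ => 3000 * ((x : ℝ) / m + (x : ℝ) ^ 2 / m ^ 2) + p)
      (poissonMeasure r) := i3.add i4
  have hpt : ∀ x : ℕ, |upperPart α c₁ m ((x : ℝ) / m) - p ^ α|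
      ≤ 3000 * ((x : ℝ) / m + (x : ℝ) ^ 2 / m ^ 2) + p := by
    intro x
    have hx : 0 ≤ (x : ℝ) / m := by positivity
    have h1 := abs_upperPart_le hα₁ hα₂ hm0 hlam hx
    have h2 := rpow_le_add_sq hα₁ hα₂ hx
    have h3 := abs_sub (upperPart α c₁ m ((x : ℝ) / m)) (p ^ α)
    rw [abs_of_nonneg (Real.rpow_nonneg hp0 α)] at h3
    rw [div_pow] at h2
    linarith
  calc _ ≤ ∫ x : ℕ, (3000 * ((x : ℝ) / m + (x : ℝ) ^ 2 / m ^ 2) + p) ∂poissonMeasure r :=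
        integral_mono (integrable_upper_bound hα₁ hα₂ hm0 hlam) i5 hpt
    _ = 3000 * (r / m + (r ^ 2 + r) / m ^ 2) + p := by
        rw [integral_add i3 i4, integral_const_mul, integral_add i1 i2,
          integral_div, integral_div, integral_cast_poisson, integral_sq_poisson, integral_const,
          probReal_univ, one_smul]
    _ = 3000 * (p + p ^ 2 + p / m) + p := by
        rw [hr]; field_simp; ring
    _ ≤ 9001 * p := by
        have h1 : p / m ≤ p := div_le_self hp0 hm
        nlinarith

/-- Here `u = p/(4Δ)`. The growth `(6u)^K ≤ e^(K(2+u))` of the polynomial outside its range is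
beaten by the lower Poisson tail, because `K ≤ λ/100`. -/
theorem six_pow_mul_pow_le {K : ℕ} {lam u : ℝ} (hK : 100 * K ≤ lam) (hlam : 1 ≤ lam)
    (hu : 1 ≤ u) :
    (2 * 6 ^ K * u ^ K + 1) * Real.exp (2 * lam * Real.log 2 - 2 * lam * u) ≤
      6 / Real.sqrt lam := by
  have h6 : (6 : ℝ) ≤ Real.exp 2 := by
    have h1 := Real.exp_one_gt_d9
    have : Real.exp 2 = Real.exp 1 * Real.exp 1 := by rw [← Real.exp_add]; norm_num
    nlinarith
  have hue : u ≤ Real.exp u := by linarith [Real.add_one_le_exp u]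
  have h1 : (6 : ℝ) ^ K * u ^ K ≤ Real.exp (K * (2 + u)) := by
    rw [← mul_pow, Real.exp_nat_mul, Real.exp_add]
    gcongr
  have h2 : 1 ≤ (6 : ℝ) ^ K * u ^ K :=
    one_le_mul_of_one_le_of_one_le (one_le_pow₀ (by norm_num)) (one_le_pow₀ hu)
  have hl2 := Real.log_two_lt_d9
  calc (2 * 6 ^ K * u ^ K + 1) * Real.exp (2 * lam * Real.log 2 - 2 * lam * u)
      ≤ (3 * Real.exp (K * (2 + u))) * Real.exp (2 * lam * Real.log 2 - 2 * lam * u) := by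
        gcongr
        linarith
    _ = 3 * Real.exp (K * (2 + u) + (2 * lam * Real.log 2 - 2 * lam * u)) := by
        rw [Real.exp_add]; ring
    _ ≤ 3 * Real.exp (-(lam / 2)) := by
        gcongr
        have a1 : (K : ℝ) * (2 + u) ≤ lam / 100 * (2 + u) := by
          gcongr; linarith
        have a2 : lam * 1 ≤ lam * u := by gcongr
        have a3 : lam * Real.log 2 ≤ lam * 0.6931471808 := by gcongr
        nlinarith
    _ ≤ 3 * (2 / lam) := by
        gcongr
        rw [Real.exp_neg, inv_le_comm₀ (Real.exp_pos _) (by positivity), inv_div]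
        linarith [Real.add_one_le_exp (lam / 2)]
    _ ≤ 6 / Real.sqrt lam := by
        have : Real.sqrt lam ≤ lam := Real.sqrt_le_self_iff.2 (Or.inr hlam)
        have hs : 0 < Real.sqrt lam := Real.sqrt_pos.2 (by linarith)
        rw [mul_div_assoc']
        norm_num
        gcongr

theorem integrable_restBound (hα₁ : 1 < α) (hα₂ : α < 3 / 2) (hm : 0 < m)
    (hlam : 2 ≤ c₁ * Real.log m) :
    Integrable (restBound α c₁ c₂ m p) ((poissonMeasure r).prod (poissonMeasure r)) := by
  have hB : Integrable (fun x : ℕ => if p ≤ 4 * Delta c₁ m then 0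
      else (4 * Delta c₁ m) ^ α * |factorialPoly α (order c₂ m) (4 * (c₁ * Real.log m)) x|
        + p ^ α) (poissonMeasure r) := by
    split_ifs
    · exact integrable_zero _ _ _
    · exact ((integrable_factorialPoly α _ _ r).abs.const_mul _).add (integrable_const _)
  have h1 : Integrable (fun y : ℕ => if (y : ℝ) ≤ 2 * (c₁ * Real.log m) then (0 : ℝ) else 1)
      (poissonMeasure r) := integrable_poisson_of_le r 1 1 fun n => by split_ifs <;> simp
  have h2 : Integrable (fun y : ℕ => if (y : ℝ) ≤ 2 * (c₁ * Real.log m) then (1 : ℝ) else 0)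
      (poissonMeasure r) := integrable_poisson_of_le r 1 1 fun n => by split_ifs <;> simp
  exact ((integrable_upper_bound hα₁ hα₂ hm hlam).mul_prod h1).add (hB.mul_prod h2)

theorem integrable_restErr (hα₁ : 1 < α) (hα₂ : α < 3 / 2) (hm : 0 < m)
    (hlam : 2 ≤ c₁ * Real.log m) (hp : 0 ≤ p) :
    Integrable (restErr α c₁ c₂ m p) ((poissonMeasure r).prod (poissonMeasure r)) :=
  (integrable_restBound (c₂ := c₂) hα₁ hα₂ hm hlam).mono'
    Measurable.of_discrete.aestronglyMeasurable
    (ae_of_all _ fun xy => abs_restErr_le hm (by linarith) hp xy)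

/-- Independence of `X` and `Y` factors the bound into value error times branch probability. The
term linear in `p` comes from symbols with `p ≤ Δ` sent to the plug-in branch; it is summed through
`∑ p = 1`. -/
theorem integral_abs_restErr_le (hα₁ : 1 < α) (hα₂ : α < 3 / 2) (hm : 1 ≤ m)
    (hlam : 2 ≤ c₁ * Real.log m) (hr : (r : ℝ) = m * p) (hp0 : 0 ≤ p) (hp1 : p ≤ 1)
    (hK : 100 * (order c₂ m : ℝ) ≤ c₁ * Real.log m) :
    ∫ xy, |restErr α c₁ c₂ m p xy| ∂(poissonMeasure r).prod (poissonMeasure r)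
      ≤ 13012 / Real.sqrt (c₁ * Real.log m) * p ^ α
        + 9001 * Real.exp (-(3 / 8 * (c₁ * Real.log m))) * p := by
  have hm0 : 0 < m := by linarith
  have hΔm : Delta c₁ m * m = c₁ * Real.log m := by rw [Delta]; field_simp
  have hΔ0 : 0 < Delta c₁ m := div_pos (by linarith) hm0
  have hpα := Real.rpow_nonneg hp0 α
  have hbd := integrable_restBound (α := α) (c₁ := c₁) (c₂ := c₂) (m := m) (p := p) (r := r)
    hα₁ hα₂ hm0 hlam
  have h0 : ∫ xy, |restErr α c₁ c₂ m p xy| ∂(poissonMeasure r).prod (poissonMeasure r)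
      ≤ ∫ xy, restBound α c₁ c₂ m p xy ∂(poissonMeasure r).prod (poissonMeasure r) :=
    integral_mono (integrable_restErr hα₁ hα₂ hm0 hlam hp0).abs hbd
      fun xy => abs_restErr_le hm0 (by linarith) hp0 xy
  refine h0.trans ?_
  set lam := c₁ * Real.log m with hlamdef
  set s := Real.sqrt lam with hs
  have hs0 : 0 < s := Real.sqrt_pos.2 (by linarith)
  set a := ∫ x : ℕ, |upperPart α c₁ m ((x : ℝ) / m) - p ^ α| ∂poissonMeasure r with ha
  set b := ∫ x : ℕ, (if p ≤ 4 * Delta c₁ m then 0 else (4 * Delta c₁ m) ^ α *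
      |factorialPoly α (order c₂ m) (4 * lam) x| + p ^ α) ∂poissonMeasure r with hb
  set P := ∫ n : ℕ, (if (n : ℝ) ≤ 2 * lam then 0 else 1 : ℝ) ∂poissonMeasure r with hP
  set Q := ∫ n : ℕ, (if (n : ℝ) ≤ 2 * lam then 1 else 0 : ℝ) ∂poissonMeasure r with hQ
  have hsplit : ∫ xy, restBound α c₁ c₂ m p xy ∂(poissonMeasure r).prod (poissonMeasure r)
      = a * P + b * Q := by
    have i1 : Integrable (fun xy : ℕ × ℕ => |upperPart α c₁ m ((xy.1 : ℝ) / m) - p ^ α| *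
        (if (xy.2 : ℝ) ≤ 2 * lam then 0 else 1)) ((poissonMeasure r).prod (poissonMeasure r)) :=
      (integrable_upper_bound hα₁ hα₂ hm0 hlam).mul_prod
        (g := fun y : ℕ => if (y : ℝ) ≤ 2 * lam then (0 : ℝ) else 1)
        (integrable_poisson_of_le r 1 1 fun n => by split_ifs <;> simp)
    have i2 : Integrable (fun xy : ℕ × ℕ => (if p ≤ 4 * Delta c₁ m then 0
        else (4 * Delta c₁ m) ^ α * |factorialPoly α (order c₂ m) (4 * lam) xy.1| + p ^ α) *
        (if (xy.2 : ℝ) ≤ 2 * lam then 1 else 0)) ((poissonMeasure r).prod (poissonMeasure r)) := by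
      refine (hbd.sub i1).congr (ae_of_all _ fun xy => ?_)
      simp only [restBound, Pi.sub_apply, ← hlamdef]
      ring
    unfold restBound
    rw [integral_add i1 i2, integral_prod_mul
      (fun x : ℕ => |upperPart α c₁ m ((x : ℝ) / m) - p ^ α|)
      (fun y : ℕ => if (y : ℝ) ≤ 2 * lam then (0 : ℝ) else 1),
      integral_prod_mul (fun x : ℕ => if p ≤ 4 * Delta c₁ m then 0 else (4 * Delta c₁ m) ^ α *
      |factorialPoly α (order c₂ m) (4 * lam) x| + p ^ α)
      (fun y : ℕ => if (y : ℝ) ≤ 2 * lam then (1 : ℝ) else 0)]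
  rw [hsplit]
  have ha0 : 0 ≤ a := integral_nonneg fun x => abs_nonneg _
  have hP01 : 0 ≤ P ∧ P ≤ 1 := integral_indicator_gt_le_one (2 * lam)
  have hQ01 : 0 ≤ Q ∧ Q ≤ 1 := integral_indicator_le_one (2 * lam)
  have hfirst : a * P ≤ 13006 / s * p ^ α + 9001 * Real.exp (-(3 / 8 * lam)) * p := by
    have hl2 := Real.log_two_gt_d9
    rcases le_total (Delta c₁ m) p with hpΔ | hpΔ
    · have h1 := integral_abs_upperPart_sub_le hα₁ hα₂ hm0 hlam hr hpΔ
      have h2 : a * P ≤ a := mul_le_of_le_one_right ha0 hP01.2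
      have h3 : 0 ≤ 9001 * Real.exp (-(3 / 8 * lam)) * p := by positivity
      linarith
    · have h1 := integral_abs_upperPart_sub_le_of_small hα₁ hα₂ hm hlam hr hp0 hp1
      have h2 : P ≤ Real.exp (-(3 / 8 * lam)) := by
        refine (integral_indicator_gt_poisson_le r (2 * lam)).trans (Real.exp_le_exp.2 ?_)
        have : (r : ℝ) ≤ lam := by rw [hr, ← hΔm]; nlinarith
        -- The exponent is at most `-(2 ln 2 - 1) λ`, and `2 ln 2 - 1 > 3/8`.
        nlinarith
      have h3 : 0 ≤ 13006 / s * p ^ α := by positivity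
      have h4 : a * P ≤ 9001 * p * Real.exp (-(3 / 8 * lam)) :=
        mul_le_mul h1 h2 hP01.1 (by positivity)
      linarith
  have hsecond : b * Q ≤ 6 / s * p ^ α := by
    by_cases hpΔ : p ≤ 4 * Delta c₁ m
    · have : b = 0 := by rw [hb]; simp [hpΔ]
      rw [this, zero_mul]
      positivity
    · have hpΔ' := hpΔ
      push Not at hpΔ'
      set K := order c₂ m
      have hu : (r : ℝ) / (4 * lam) = p / (4 * Delta c₁ m) := by
        rw [hr, ← hΔm]; field_simp
      set u := (r : ℝ) / (4 * lam) with hudef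
      have hu1 : 1 ≤ u := by rw [hu, one_le_div (by positivity)]; exact hpΔ'.le
      have hru : (r : ℝ) = 4 * lam * u := by rw [hudef]; field_simp
      have hMr : 4 * lam ≤ r := by rw [hru]; nlinarith
      have hD : (4 * Delta c₁ m) ^ α ≤ p ^ α :=
        Real.rpow_le_rpow (by positivity) hpΔ'.le (by linarith)
      have hb1 : b ≤ p ^ α * (2 * 6 ^ K * u ^ K + 1) := by
        rw [hb]
        simp only [if_neg hpΔ]
        rw [integral_add ((integrable_factorialPoly α _ _ r).abs.const_mul _) (integrable_const _),
          integral_const_mul, integral_const, probReal_univ, one_smul, mul_add, mul_one]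
        gcongr
        exact integral_abs_factorialPoly_le (by linarith) (by positivity) hMr
      have hQ1 : Q ≤ Real.exp (2 * lam * Real.log 2 - 2 * lam * u) := by
        refine (integral_indicator_le_poisson_le r (2 * lam)).trans (le_of_eq ?_)
        rw [hru]; congr 1; ring
      calc b * Q ≤ p ^ α * (2 * 6 ^ K * u ^ K + 1) *
            Real.exp (2 * lam * Real.log 2 - 2 * lam * u) :=
            mul_le_mul hb1 hQ1 hQ01.1 (by positivity)
        _ = p ^ α * ((2 * 6 ^ K * u ^ K + 1) *
            Real.exp (2 * lam * Real.log 2 - 2 * lam * u)) := by ring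
        _ ≤ p ^ α * (6 / s) := by
            gcongr
            exact six_pow_mul_pow_le hK (by linarith) hu1
        _ = _ := by ring
  calc a * P + b * Q ≤ (13006 / s * p ^ α + 9001 * Real.exp (-(3 / 8 * lam)) * p)
        + 6 / s * p ^ α := add_le_add hfirst hsecond
    _ = _ := by ring

end OneSymbol

/-! ### From one symbol to the whole sample -/

/-- The threshold `3τ` is shared by the mean of `∑ A`, its fluctuation (Chebyshev) and `∑ |R|`
(Markov). `A i` and `R i` may depend on each other. -/
theorem measure_pi_sum_add_ge_le {ι Ω : Type*} [Fintype ι] [MeasurableSpace Ω]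
    (ν : ι → Measure Ω) [∀ i, IsProbabilityMeasure (ν i)] (A R : ι → Ω → ℝ)
    (hA : ∀ i, MemLp (A i) 2 (ν i)) (hR : ∀ i, Integrable (R i) (ν i)) {τ V W : ℝ} (hτ : 0 < τ)
    (hmean : ∑ i, |∫ x, A i x ∂ν i| ≤ τ) (hV : ∑ i, ∫ x, A i x ^ 2 ∂ν i ≤ V)
    (hW : ∑ i, ∫ x, |R i x| ∂ν i ≤ W) :
    Measure.pi ν {ω | 3 * τ ≤ |∑ i, (A i (ω i) + R i (ω i))|}
      ≤ ENNReal.ofReal (V / τ ^ 2 + W / τ) := by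
  have hAi : ∀ i, Integrable (fun ω : ι → Ω => A i (ω i)) (Measure.pi ν) :=
    fun i => integrable_comp_eval ((hA i).integrable one_le_two)
  have hRi : ∀ i, Integrable (fun ω : ι → Ω => |R i (ω i)|) (Measure.pi ν) :=
    fun i => (integrable_comp_eval (hR i)).abs
  set X : (ι → Ω) → ℝ := ∑ i, fun ω => A i (ω i) with hX
  have hXω : ∀ ω, X ω = ∑ i, A i (ω i) := fun ω => by rw [hX, Finset.sum_apply]
  have hXL : MemLp X 2 (Measure.pi ν) :=
    memLp_finsetSum' _ fun i _ => (hA i).comp_measurePreserving (measurePreserving_eval ν i)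
  have hEX : |∫ ω, X ω ∂Measure.pi ν| ≤ τ := by
    simp_rw [hXω]
    rw [integral_finsetSum _ fun i _ => hAi i]
    refine (Finset.abs_sum_le_sum_abs _ _).trans (le_trans (le_of_eq ?_) hmean)
    refine Finset.sum_congr rfl fun i _ => ?_
    rw [integral_comp_eval (hA i).aestronglyMeasurable]
  have hVar : Var[X; Measure.pi ν] ≤ V := by
    rw [hX, variance_sum_pi hA]
    refine (Finset.sum_le_sum fun i _ => ?_).trans hV
    exact variance_le_expectation_sq (hA i).aestronglyMeasurable
  have h1 : Measure.pi ν {ω | τ ≤ |X ω - ∫ ω, X ω ∂Measure.pi ν|} ≤ ENNReal.ofReal (V / τ ^ 2) :=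
    (meas_ge_le_variance_div_sq hXL hτ).trans (ENNReal.ofReal_le_ofReal (by gcongr))
  set Y : (ι → Ω) → ℝ := fun ω => ∑ i, |R i (ω i)| with hY
  have hYi : Integrable Y (Measure.pi ν) := integrable_finsetSum _ fun i _ => hRi i
  have hEY : ∫ ω, Y ω ∂Measure.pi ν ≤ W := by
    rw [hY, integral_finsetSum _ fun i _ => hRi i]
    refine le_trans (le_of_eq (Finset.sum_congr rfl fun i _ => ?_)) hW
    exact integral_comp_eval (μ := ν) (f := fun x => |R i x|) (hR i).abs.aestronglyMeasurable
  have h2 : Measure.pi ν {ω | τ ≤ Y ω} ≤ ENNReal.ofReal (W / τ) := by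
    have h := mul_meas_ge_le_integral_of_nonneg
      (ae_of_all (Measure.pi ν) fun ω => Finset.sum_nonneg fun i _ => abs_nonneg (R i (ω i)))
      hYi τ
    rw [← ofReal_measureReal]
    refine ENNReal.ofReal_le_ofReal ?_
    rw [le_div_iff₀ hτ, mul_comm]
    exact h.trans hEY
  have hV0 : 0 ≤ V :=
    (Finset.sum_nonneg fun i _ => integral_nonneg fun x => sq_nonneg (A i x)).trans hV
  have hW0 : 0 ≤ W :=
    (Finset.sum_nonneg fun i _ => integral_nonneg fun x => abs_nonneg (R i x)).trans hW
  rw [ENNReal.ofReal_add (by positivity) (by positivity)]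
  refine le_trans (measure_mono fun ω hω => ?_) ((measure_union_le _ _).trans (add_le_add h1 h2))
  by_contra hcon
  simp only [Set.mem_union, Set.mem_ofPred_eq, not_or, not_le] at hcon hω
  obtain ⟨g1, g2⟩ := hcon
  rw [Finset.sum_add_distrib, ← hXω] at hω
  have g3 : |∑ i, R i (ω i)| ≤ Y ω := Finset.abs_sum_le_sum_abs _ _
  have g4 := abs_add_le (X ω) (∑ i, R i (ω i))
  have g5 := abs_add_le (X ω - ∫ ω, X ω ∂Measure.pi ν) (∫ ω, X ω ∂Measure.pi ν)
  rw [sub_add_cancel] at g5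
  linarith

theorem card_rpow_le_powerSum {S : ℕ} {α : ℝ} (hα : 1 ≤ α) (hS : 1 ≤ S) {p : Fin S → ℝ}
    (hp : p ∈ stdSimplex ℝ (Fin S)) : (S : ℝ) ^ (1 - α) ≤ powerSum α p := by
  have h := Real.rpow_sum_le_const_mul_sum_rpow_of_nonneg Finset.univ hα
    (f := p) (fun i _ => hp.1 i)
  rw [hp.2, Real.one_rpow, Finset.card_univ, Fintype.card_fin] at h
  have hS0 : (0 : ℝ) < S := by exact_mod_cast hS
  rw [show 1 - α = -(α - 1) by ring, Real.rpow_neg hS0.le, inv_le_iff_one_le_mul₀ (by positivity),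
    mul_comm]
  exact h

/-- If the estimate is within a factor `1 ± η` of the power sum, it is positive and its logarithm is
off by less than `2η ≤ δ(α-1)`. -/
theorem failureEvent_subset {S : ℕ} {α c₁ c₂ δ n η : ℝ} (hα : 1 < α) {p : Fin S → ℝ}
    (hF : 0 < powerSum α p) (hη₀ : 0 < η) (hη : η ≤ 1 / 2) (hηδ : 2 * η ≤ δ * (α - 1)) :
    failureEvent α c₁ c₂ δ n p
      ⊆ {xy | η * powerSum α p ≤ |estimator α c₁ c₂ (n / 2) xy - powerSum α p|} := by
  intro xy hxy
  by_contra hcon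
  simp only [Set.mem_ofPred_eq, not_le] at hcon
  set F := powerSum α p with hFdef
  set G := estimator α c₁ c₂ (n / 2) xy with hG
  obtain ⟨h1, h2⟩ := abs_lt.1 hcon
  have hG0 : 0 < G := by nlinarith
  rcases hxy with h | h
  · exact absurd h (not_le.2 hG0)
  · rw [renyiEntropy, ← hFdef, ← hG, ← sub_div, ← Real.log_div hG0.ne' hF.ne', abs_div,
      abs_of_neg (by linarith : 1 - α < 0), le_div_iff₀ (by linarith)] at h
    have hx1 : G / F < 1 + η := by rw [div_lt_iff₀ hF]; linarith
    have hx2 : 1 - η < G / F := by rw [lt_div_iff₀ hF]; linarith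
    have hx0 : 0 < G / F := by positivity
    have hlog1 : Real.log (G / F) ≤ G / F - 1 := Real.log_le_sub_one_of_pos hx0
    have hlog2 : 1 - (G / F)⁻¹ ≤ Real.log (G / F) := Real.one_sub_inv_le_log_of_pos hx0
    have hinv : (G / F)⁻¹ < 1 + 2 * η := by
      rw [inv_lt_iff_one_lt_mul₀ hx0]
      nlinarith
    have : |Real.log (G / F)| < 2 * η := abs_lt.2 ⟨by linarith, by linarith⟩
    linarith

/-- All requirements on the parameters are free of `p`: errors uniform over symbols are compared
with `S^(1-α)`, which bounds the power sum from below, and only `w₁` multiplies the power sum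
itself. -/
theorem sampleLaw_failureEvent_le {S : ℕ} {α c₁ c₂ δ n η τ₀ V₀ w₁ w₂ ε : ℝ} (hα₁ : 1 < α)
    (hα₂ : α < 3 / 2) (hS : 1 ≤ S) {p : Fin S → ℝ} (hp : p ∈ stdSimplex ℝ (Fin S))
    (hη₀ : 0 < η) (hη : η ≤ 1 / 2) (hηδ : 2 * η ≤ δ * (α - 1)) (hm : 1 ≤ n / 2)
    (hlam : 2 ≤ c₁ * Real.log (n / 2))
    (hK : 100 * (order c₂ (n / 2) : ℝ) ≤ c₁ * Real.log (n / 2)) {E : ℝ}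
    (hE : ∀ x ∈ Set.Icc (0 : ℝ) 1, |(bestPoly α (order c₂ (n / 2))).eval x - x ^ α| ≤ E)
    (hτ₀ : τ₀ = η / 3)
    (hbias : S * (2 * E * (4 * Delta c₁ (n / 2)) ^ α + ((4 * Delta c₁ (n / 2)) ^ α) ^ 2 *
      (4 * 2 ^ (10 * order c₂ (n / 2)))) ≤ τ₀ * (S : ℝ) ^ (1 - α))
    (hvar : S * (((4 * Delta c₁ (n / 2)) ^ α) ^ 2 * (10 * 2 ^ (10 * order c₂ (n / 2))))
      ≤ V₀ * ((S : ℝ) ^ (1 - α)) ^ 2)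
    (hw₁ : 13012 / Real.sqrt (c₁ * Real.log (n / 2)) ≤ w₁)
    (hw₂ : 9001 * Real.exp (-(3 / 8 * (c₁ * Real.log (n / 2)))) ≤ w₂ * (S : ℝ) ^ (1 - α))
    (hV₀ : 0 ≤ V₀) (hw₂' : 0 ≤ w₂) (hε : V₀ / τ₀ ^ 2 + (w₁ + w₂) / τ₀ ≤ ε) :
    sampleLaw n p (failureEvent α c₁ c₂ δ n p) ≤ ENNReal.ofReal ε := by
  set m := n / 2 with hmdef
  have hm0 : 0 < m := by linarith
  have hS0 : (0 : ℝ) < S := by exact_mod_cast hS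
  set F := powerSum α p with hF
  have hSF : (S : ℝ) ^ (1 - α) ≤ F := card_rpow_le_powerSum hα₁.le hS hp
  have hSpos : 0 < (S : ℝ) ^ (1 - α) := by positivity
  have hF0 : 0 < F := hSpos.trans_le hSF
  have hτ₀0 : 0 < τ₀ := by rw [hτ₀]; positivity
  have hp0 := hp.1
  have hp1 : ∀ i, p i ≤ 1 := fun i => by
    rw [← hp.2]
    exact Finset.single_le_sum (fun j _ => hp0 j) (Finset.mem_univ i)
  have hK' : (order c₂ m : ℝ) ≤ c₁ * Real.log m := by
    linarith [(Nat.cast_nonneg (order c₂ m) : (0 : ℝ) ≤ _)]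
  set r : Fin S → ℝ≥0 := fun i => (n * p i).toNNReal / 2 with hr
  have hrr : ∀ i, (r i : ℝ) = m * p i := fun i => by
    rw [hr]
    push_cast
    rw [Real.coe_toNNReal _ (mul_nonneg (by linarith) (hp0 i)), hmdef]
    ring
  have hlaw : sampleLaw n p
      = Measure.pi fun i => (poissonMeasure (r i)).prod (poissonMeasure (r i)) := by
    unfold sampleLaw
    simp_rw [splitLaw_eq_prod]
    rfl
  rw [hlaw]
  have hmain := measure_pi_sum_add_ge_le
    (fun i => (poissonMeasure (r i)).prod (poissonMeasure (r i)))
    (fun i => polyErr α c₁ c₂ m (p i)) (fun i => restErr α c₁ c₂ m (p i))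
    (fun i => memLp_polyErr (by linarith) hm0 (by linarith) (hp0 i))
    (fun i => integrable_restErr hα₁ hα₂ hm0 hlam (hp0 i)) (τ := τ₀ * F)
    (V := V₀ * F ^ 2) (W := (w₁ + w₂) * F) (by positivity) ?_ ?_ ?_
  · refine le_trans (measure_mono fun xy hxy => ?_) (hmain.trans (ENNReal.ofReal_le_ofReal ?_))
    · have h := failureEvent_subset hα₁ hF0 hη₀ hη hηδ hxy
      simp only [Set.mem_ofPred_eq] at h ⊢
      rw [show 3 * (τ₀ * F) = η * F by rw [hτ₀]; ring]
      refine h.trans (le_of_eq ?_)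
      congr 1
      rw [powerSum, estimator, ← Finset.sum_sub_distrib]
      refine Finset.sum_congr rfl fun i _ => ?_
      simp only [restErr, symbolEst]
      ring
    · refine le_trans (le_of_eq ?_) hε
      field_simp
  · have hb : ∀ i, |∫ xy, polyErr α c₁ c₂ m (p i) xy
        ∂(poissonMeasure (r i)).prod (poissonMeasure (r i))|
        ≤ 2 * E * (4 * Delta c₁ m) ^ α + ((4 * Delta c₁ m) ^ α) ^ 2 * (4 * 2 ^ (10 * order c₂ m)) :=
      fun i => abs_integral_polyErr_le (by linarith) hm0 (by linarith) (hrr i) hK' hE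
    refine (Finset.sum_le_sum fun i _ => hb i).trans ?_
    rw [Finset.sum_const, Finset.card_univ, Fintype.card_fin, nsmul_eq_mul]
    exact hbias.trans (by gcongr)
  · have hb : ∀ i, ∫ xy, polyErr α c₁ c₂ m (p i) xy ^ 2
        ∂(poissonMeasure (r i)).prod (poissonMeasure (r i))
        ≤ ((4 * Delta c₁ m) ^ α) ^ 2 * (10 * 2 ^ (10 * order c₂ m)) :=
      fun i => integral_polyErr_sq_le (by linarith) hm0 (by linarith) (hrr i) (hp0 i) hK'
    refine (Finset.sum_le_sum fun i _ => hb i).trans ?_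
    rw [Finset.sum_const, Finset.card_univ, Fintype.card_fin, nsmul_eq_mul]
    exact hvar.trans (by gcongr)
  · refine (Finset.sum_le_sum fun i _ => integral_abs_restErr_le hα₁ hα₂ hm hlam (hrr i) (hp0 i)
      (hp1 i) hK).trans ?_
    rw [Finset.sum_add_distrib, ← Finset.mul_sum, ← Finset.mul_sum, hp.2, mul_one]
    have h1 : 13012 / Real.sqrt (c₁ * Real.log m) * ∑ i, p i ^ α ≤ w₁ * F :=
      mul_le_mul_of_nonneg_right hw₁ hF0.le
    have h2 : w₂ * (S : ℝ) ^ (1 - α) ≤ w₂ * F := by gcongr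
    linarith

/-! ### Choice of the constant and asymptotics in `m` -/

open Filter Topology

theorem eventually_log_rpow_mul_rpow_le (C a : ℝ) {b v : ℝ} (hb : 0 < b) (hv : 0 < v) :
    ∀ᶠ m : ℝ in atTop, C * (Real.log m ^ a * m ^ (-b)) ≤ v := by
  have h := (isLittleO_log_rpow_rpow_atTop a hb).tendsto_div_nhds_zero.const_mul C
  rw [mul_zero] at h
  filter_upwards [h.eventually_le_const hv, eventually_gt_atTop 0] with m hm hm0
  rw [Real.rpow_neg hm0.le, ← div_eq_mul_inv]
  exact hm

theorem two_pow_order_le {α c₂ m : ℝ} (hc₂ : 0 < c₂)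
    (hc₂' : 10 * c₂ * Real.log 2 < 2 * α - 2) (hm : 1 ≤ m) :
    (2 : ℝ) ^ (10 * order c₂ m) ≤ m ^ (2 * α - 2) := by
  have hℓ : 0 ≤ Real.log m := Real.log_nonneg hm
  have hK : (order c₂ m : ℝ) ≤ c₂ * Real.log m := Nat.floor_le (by positivity)
  have hl2 : 0 < Real.log 2 := Real.log_pos one_lt_two
  rw [Real.rpow_def_of_pos (by linarith), ← Real.rpow_natCast, Real.rpow_def_of_pos two_pos]
  refine Real.exp_le_exp.2 ?_
  push_cast
  calc Real.log 2 * (10 * (order c₂ m : ℝ)) ≤ Real.log 2 * (10 * (c₂ * Real.log m)) := by gcongr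
    _ = 10 * c₂ * Real.log 2 * Real.log m := by ring
    _ ≤ (2 * α - 2) * Real.log m := by gcongr
    _ = _ := by ring

theorem sq_scale_mul_two_pow_le {α c₁ c₂ m : ℝ} (hc₁ : 0 < c₁) (hc₂ : 0 < c₂)
    (hc₂' : 10 * c₂ * Real.log 2 < 2 * α - 2) (hm : 1 ≤ m) :
    ((4 * Delta c₁ m) ^ α) ^ 2 * 2 ^ (10 * order c₂ m)
      ≤ ((4 * c₁) ^ α) ^ 2 * (Real.log m ^ (2 * α) * m ^ (-2 : ℝ)) := by
  have hℓ : 0 ≤ Real.log m := Real.log_nonneg hm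
  have hm0 : 0 < m := by linarith
  have h1 : 4 * Delta c₁ m = 4 * c₁ * Real.log m * m⁻¹ := by rw [Delta]; field_simp
  calc ((4 * Delta c₁ m) ^ α) ^ 2 * 2 ^ (10 * order c₂ m)
      ≤ ((4 * Delta c₁ m) ^ α) ^ 2 * m ^ (2 * α - 2) := by
        gcongr; exact two_pow_order_le hc₂ hc₂' hm
    _ = ((4 * c₁) ^ α) ^ 2 * (Real.log m ^ (2 * α) * m ^ (-2 : ℝ)) := by
        rw [h1, Real.mul_rpow (by positivity) (by positivity),
          Real.mul_rpow (by positivity) hℓ, Real.inv_rpow hm0.le, ← Real.rpow_neg hm0.le,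
          mul_pow, mul_pow, ← Real.rpow_mul_natCast hℓ, ← Real.rpow_mul_natCast hm0.le, mul_assoc,
          mul_assoc, ← Real.rpow_add hm0]
        congr 2
        · congr 1; push_cast; ring
        · congr 1; push_cast; ring

/-- After division by the matching power of `S` and use of `S ≤ m ln m`, every term but one is a
power of `ln m` times a negative power of `m`. In the exception, the approximation bias, all powers
of `m` and `ln m` cancel, leaving `B·4/c`. -/
theorem exists_parameters {α c₁ c₂ : ℝ} (hα₁ : 1 < α) (hα₂ : α < 3 / 2) (hc₁ : 16 * α < c₁)
    (hc₂ : 0 < c₂) (hc₂' : 10 * c₂ * Real.log 2 < 2 * α - 2) {τ₀ V₀ w₁ w₂ : ℝ} (hτ₀ : 0 < τ₀)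
    (hV₀ : 0 < V₀) (hw₁ : 0 < w₁) (hw₂ : 0 < w₂) :
    ∃ c : ℝ, 4 ≤ c ∧ ∀ᶠ m : ℝ in atTop, 1 ≤ m ∧ 2 ≤ c₁ * Real.log m ∧
      100 * (order c₂ m : ℝ) ≤ c₁ * Real.log m ∧
      13012 / Real.sqrt (c₁ * Real.log m) ≤ w₁ ∧
      ∀ S : ℕ, 1 ≤ S → (S : ℝ) ≤ 4 / c * (m * Real.log m) →
      9001 * Real.exp (-(3 / 8 * (c₁ * Real.log m))) ≤ w₂ * (S : ℝ) ^ (1 - α) ∧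
      S * (((4 * Delta c₁ m) ^ α) ^ 2 * (10 * 2 ^ (10 * order c₂ m)))
        ≤ V₀ * ((S : ℝ) ^ (1 - α)) ^ 2 ∧
      ∃ E : ℝ, (∀ x ∈ Set.Icc (0 : ℝ) 1, |(bestPoly α (order c₂ m)).eval x - x ^ α| ≤ E) ∧
        S * (2 * E * (4 * Delta c₁ m) ^ α + ((4 * Delta c₁ m) ^ α) ^ 2 *
          (4 * 2 ^ (10 * order c₂ m))) ≤ τ₀ * (S : ℝ) ^ (1 - α) := by
  obtain ⟨C₀, hC₀, happrox⟩ := exists_abs_eval_bestPoly_sub_le (α := α) (by linarith) (by linarith)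
  set B := 2 * C₀ * (c₂ / 2) ^ (-(2 * α)) * (4 * c₁) ^ α with hB
  have hc₁0 : 0 < c₁ := by linarith
  have hB0 : 0 ≤ B := by positivity
  -- The second summand gives `4B/c ≤ τ₀/2`; the 4 gives `4/c ≤ 1`.
  set c := 4 + 8 * B / τ₀ with hc
  have hc4 : 4 ≤ c := by rw [hc]; linarith [show 0 ≤ 8 * B / τ₀ by positivity]
  have hBc : B * (4 / c) ≤ τ₀ / 2 := by
    rw [mul_div_assoc', div_le_iff₀ (by linarith), hc]
    have : 8 * B / τ₀ * τ₀ = 8 * B := by field_simp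
    nlinarith
  refine ⟨c, hc4, ?_⟩
  have hlog : Tendsto Real.log atTop atTop := Real.tendsto_log_atTop
  have hsqrt : Tendsto (fun m : ℝ => 13012 / Real.sqrt (c₁ * Real.log m)) atTop (𝓝 0) :=
    Tendsto.const_div_atTop (Real.tendsto_sqrt_atTop.comp (hlog.const_mul_atTop hc₁0)) _
  set D₁ := ((4 * c₁) ^ α) ^ 2 with hD₁
  have hD₁0 : 0 ≤ D₁ := sq_nonneg _
  have ev1 := eventually_log_rpow_mul_rpow_le 9001 (α - 1) (b := 7 - α) (v := w₂)
    (by linarith) hw₂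
  have ev2 := eventually_log_rpow_mul_rpow_le (10 * D₁) (4 * α - 1) (b := 3 - 2 * α) (v := V₀)
    (by linarith) hV₀
  have ev3 := eventually_log_rpow_mul_rpow_le (4 * D₁) (3 * α) (b := 2 - α) (v := τ₀ / 2)
    (by linarith) (by positivity)
  filter_upwards [eventually_ge_atTop 1, hlog.eventually_ge_atTop 1,
    hlog.eventually_ge_atTop (2 / c₂), hsqrt.eventually_le_const hw₁, ev1, ev2, ev3]
    with m hm1 hℓ1 hℓ2 hs1 hev1 hev2 hev3
  have hm0 : 0 < m := by linarith
  set ℓ := Real.log m with hℓ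
  have hℓ0 : 0 < ℓ := by linarith
  have hlam : 16 * ℓ ≤ c₁ * ℓ := by gcongr; linarith
  have hl2 := Real.log_two_gt_d9
  -- From `10 c₂ ln 2 < 2α - 2 < 1`; together with `c₁ > 16` this gives `100 K ≤ λ`.
  have hc₂small : 100 * c₂ ≤ 16 := by nlinarith
  set K := order c₂ m with hKdef
  have hKle : (K : ℝ) ≤ c₂ * ℓ := Nat.floor_le (by positivity)
  have hc₂ℓ : 2 ≤ c₂ * ℓ := by rw [div_le_iff₀ hc₂] at hℓ2; linarith
  have hKge : c₂ / 2 * ℓ ≤ K := by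
    have : c₂ * ℓ < K + 1 := Nat.lt_floor_add_one _
    linarith
  have hK1 : 1 ≤ K := by
    have : (1 : ℝ) ≤ K := by linarith
    exact_mod_cast this
  refine ⟨hm1, by linarith, by nlinarith, hs1, fun S hS hSm => ?_⟩
  have hS0 : (0 : ℝ) < S := by exact_mod_cast hS
  have hcle : 4 / c ≤ 1 := (div_le_one (by linarith)).2 hc4
  have hSmℓ : (S : ℝ) ≤ m * ℓ := hSm.trans (mul_le_of_le_one_left (by positivity) hcle)
  have hSp : ∀ e : ℝ, 0 ≤ e → (S : ℝ) ^ e ≤ ℓ ^ e * m ^ e := fun e he => by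
    rw [mul_comm, ← Real.mul_rpow hm0.le hℓ0.le]
    exact Real.rpow_le_rpow hS0.le hSmℓ he
  have hDD := sq_scale_mul_two_pow_le (α := α) (c₁ := c₁) hc₁0 hc₂ hc₂' hm1
  rw [← hℓ, ← hD₁, ← hKdef] at hDD
  have hT : 0 < (S : ℝ) ^ (1 - α) := by positivity
  have hsplit1 : (S : ℝ) ^ (1 - α) * (S : ℝ) ^ (α - 1) = 1 := by
    rw [← Real.rpow_add hS0]; simp
  have hsplit2 : (S : ℝ) ^ (1 - α) * (S : ℝ) ^ α = S := by
    rw [← Real.rpow_add hS0]; simp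
  have hsplit3 : ((S : ℝ) ^ (1 - α)) ^ 2 * (S : ℝ) ^ (2 * α - 1) = S := by
    rw [← Real.rpow_mul_natCast hS0.le, ← Real.rpow_add hS0]
    convert Real.rpow_one (S : ℝ) using 2
    push_cast; ring
  refine ⟨?_, ?_, C₀ * (K : ℝ) ^ (-(2 * α)), happrox K hK1, ?_⟩
  -- The exponent 6 is `(3/8)·16`.
  · have h1 : Real.exp (-(3 / 8 * (c₁ * ℓ))) ≤ m ^ (-6 : ℝ) := by
      rw [Real.rpow_def_of_pos hm0]
      exact Real.exp_le_exp.2 (by linarith)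
    have h2 : 9001 * Real.exp (-(3 / 8 * (c₁ * ℓ))) * (S : ℝ) ^ (α - 1) ≤ w₂ := by
      calc _ ≤ 9001 * m ^ (-6 : ℝ) * (ℓ ^ (α - 1) * m ^ (α - 1)) := by
            gcongr
            exact hSp _ (by linarith)
        _ = 9001 * (ℓ ^ (α - 1) * (m ^ (-6 : ℝ) * m ^ (α - 1))) := by ring
        _ = 9001 * (ℓ ^ (α - 1) * m ^ (-(7 - α))) := by
            rw [← Real.rpow_add hm0]; congr 3; ring
        _ ≤ w₂ := hev1
    calc _ = 9001 * Real.exp (-(3 / 8 * (c₁ * ℓ))) * (S : ℝ) ^ (α - 1) * (S : ℝ) ^ (1 - α) := by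
          rw [mul_assoc _ ((S : ℝ) ^ (α - 1)), mul_comm ((S : ℝ) ^ (α - 1)), hsplit1, mul_one]
      _ ≤ _ := by gcongr
  · have h2 : (S : ℝ) ^ (2 * α - 1) * (((4 * Delta c₁ m) ^ α) ^ 2 * (10 * 2 ^ (10 * K))) ≤ V₀ := by
      calc _ = (S : ℝ) ^ (2 * α - 1) * (10 * (((4 * Delta c₁ m) ^ α) ^ 2 * 2 ^ (10 * K))) := by ring
        _ ≤ (ℓ ^ (2 * α - 1) * m ^ (2 * α - 1)) *
            (10 * (D₁ * (ℓ ^ (2 * α) * m ^ (-2 : ℝ)))) := by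
            gcongr
            exact hSp _ (by linarith)
        _ = 10 * D₁ * ((ℓ ^ (2 * α - 1) * ℓ ^ (2 * α)) * (m ^ (2 * α - 1) * m ^ (-2 : ℝ))) := by
            ring
        _ = 10 * D₁ * (ℓ ^ (4 * α - 1) * m ^ (-(3 - 2 * α))) := by
            rw [← Real.rpow_add hm0, ← Real.rpow_add hℓ0]
            congr 3 <;> ring
        _ ≤ V₀ := hev2
    calc (S : ℝ) * (((4 * Delta c₁ m) ^ α) ^ 2 * (10 * 2 ^ (10 * K)))
        = (S : ℝ) ^ (2 * α - 1) * (((4 * Delta c₁ m) ^ α) ^ 2 * (10 * 2 ^ (10 * K)))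
          * ((S : ℝ) ^ (1 - α)) ^ 2 := by
          nth_rewrite 1 [← hsplit3]; ring
      _ ≤ _ := by gcongr
  · have h1 : (S : ℝ) ^ α * (2 * (C₀ * (K : ℝ) ^ (-(2 * α))) * (4 * Delta c₁ m) ^ α) ≤ τ₀ / 2 := by
      have hΔ : 4 * Delta c₁ m = 4 * c₁ * (ℓ * m⁻¹) := by
        rw [Delta, ← hℓ]; field_simp
      have hΔ0 : 0 ≤ Delta c₁ m := div_nonneg (by positivity) hm0.le
      have hKp : (K : ℝ) ^ (-(2 * α)) ≤ (c₂ / 2) ^ (-(2 * α)) * ℓ ^ (-(2 * α)) := by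
        rw [← Real.mul_rpow (by positivity) hℓ0.le]
        exact Real.rpow_le_rpow_of_nonpos (by positivity) hKge (by linarith)
      have hSα : (S : ℝ) ^ α ≤ 4 / c * (ℓ ^ α * m ^ α) := by
        calc (S : ℝ) ^ α ≤ (4 / c * (m * ℓ)) ^ α := Real.rpow_le_rpow hS0.le hSm (by linarith)
          _ = (4 / c) ^ α * (ℓ ^ α * m ^ α) := by
            rw [Real.mul_rpow (by positivity) (by positivity), Real.mul_rpow hm0.le hℓ0.le]
            ring
          _ ≤ 4 / c * (ℓ ^ α * m ^ α) := by
            gcongr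
            have := Real.rpow_le_rpow_of_exponent_ge' (by positivity) hcle zero_le_one hα₁.le
            rwa [Real.rpow_one] at this
      calc _ ≤ 4 / c * (ℓ ^ α * m ^ α) * (2 * (C₀ * ((c₂ / 2) ^ (-(2 * α)) * ℓ ^ (-(2 * α))))
            * (4 * Delta c₁ m) ^ α) := by
            gcongr
        _ = B * (4 / c) * ((ℓ ^ α * ℓ ^ (-(2 * α)) * ℓ ^ α) * (m ^ α * m ^ (-α))) := by
            rw [hΔ, Real.mul_rpow (by positivity) (by positivity),
              Real.mul_rpow hℓ0.le (by positivity), Real.inv_rpow hm0.le,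
              ← Real.rpow_neg hm0.le, hB]
            ring
        _ = B * (4 / c) := by
            rw [← Real.rpow_add hm0, ← Real.rpow_add hℓ0, ← Real.rpow_add hℓ0]
            rw [show α + -(2 * α) + α = 0 by ring, show α + -α = 0 by ring]
            simp
        _ ≤ τ₀ / 2 := hBc
    have h2 : (S : ℝ) ^ α * (((4 * Delta c₁ m) ^ α) ^ 2 * (4 * 2 ^ (10 * K))) ≤ τ₀ / 2 := by
      calc _ = (S : ℝ) ^ α * (4 * (((4 * Delta c₁ m) ^ α) ^ 2 * 2 ^ (10 * K))) := by ring
        _ ≤ (ℓ ^ α * m ^ α) * (4 * (D₁ * (ℓ ^ (2 * α) * m ^ (-2 : ℝ)))) := by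
            gcongr
            exact hSp _ (by linarith)
        _ = 4 * D₁ * ((ℓ ^ α * ℓ ^ (2 * α)) * (m ^ α * m ^ (-2 : ℝ))) := by
            ring
        _ = 4 * D₁ * (ℓ ^ (3 * α) * m ^ (-(2 - α))) := by
            rw [← Real.rpow_add hm0, ← Real.rpow_add hℓ0]
            congr 3 <;> ring
        _ ≤ τ₀ / 2 := hev3
    set X := 2 * (C₀ * (K : ℝ) ^ (-(2 * α))) * (4 * Delta c₁ m) ^ α
    set Z := ((4 * Delta c₁ m) ^ α) ^ 2 * (4 * 2 ^ (10 * K))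
    calc (S : ℝ) * (X + Z) = ((S : ℝ) ^ α * X + (S : ℝ) ^ α * Z) * (S : ℝ) ^ (1 - α) := by
          nth_rewrite 1 [← hsplit2]; ring
      _ ≤ τ₀ * (S : ℝ) ^ (1 - α) := by
          gcongr
          linarith

/-- The bound `n/2 ≥ √S` makes statements about large `m` uniform over the admissible `n`. It also
gives `ln(n/2) ≥ (ln S)/2`, which converts `n ≥ cS/ln S` into a bound of `S` by `m ln m`. -/
theorem sample_size_bounds {c n : ℝ} {S : ℕ} (hc : 4 ≤ c) (hS : 2 ≤ S)
    (hn : c * (S : ℝ) / Real.log S ≤ n) :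
    Real.sqrt S ≤ n / 2 ∧ (S : ℝ) ≤ 4 / c * (n / 2 * Real.log (n / 2)) := by
  have hS2 : (2 : ℝ) ≤ S := by exact_mod_cast hS
  have hS0 : (0 : ℝ) < S := by linarith
  have hL : 0 < Real.log S := Real.log_pos (by linarith)
  have hs0 : 0 < Real.sqrt S := Real.sqrt_pos.2 hS0
  have hlogs : Real.log (Real.sqrt S) = Real.log S / 2 := Real.log_sqrt hS0.le
  have hLs : Real.log S ≤ 2 * Real.sqrt S := by
    have := Real.log_le_sub_one_of_pos hs0
    rw [hlogs] at this
    linarith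
  rw [div_le_iff₀ hL] at hn
  have hss : Real.sqrt S * Real.sqrt S = S := Real.mul_self_sqrt hS0.le
  have hn0 : 0 < n := by
    by_contra h
    push Not at h
    nlinarith
  have h1 : Real.sqrt S ≤ n / 2 := by
    have h2 : 4 * (S : ℝ) ≤ n * (2 * Real.sqrt S) := by nlinarith
    have h3 : 2 * Real.sqrt S * Real.sqrt S ≤ n * Real.sqrt S := by nlinarith
    have := le_of_mul_le_mul_right h3 hs0
    linarith
  refine ⟨h1, ?_⟩
  have hlog : Real.log S / 2 ≤ Real.log (n / 2) := by
    rw [← hlogs]; exact Real.log_le_log hs0 h1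
  rw [div_mul_eq_mul_div, le_div_iff₀ (by linarith)]
  nlinarith

end RenyiEst

theorem theorem5 (α : ℝ) (hα₁ : 1 < α) (hα₂ : α < 3 / 2)
    (c₁ c₂ : ℝ) (hc₁ : 16 * α < c₁) (hc₂ : 0 < c₂) (hc₂' : 10 * c₂ * Real.log 2 < 2 * α - 2)
    (δ ε : ℝ) (hδ : 0 < δ) (hε₀ : 0 < ε) (hε₁ : ε < 1) :
    ∃ c : ℝ, 0 < c ∧
      Filter.limsup (fun S : ℕ =>
        ⨆ (p : stdSimplex ℝ (Fin S)) (n : ℝ) (_ : c * (S : ℝ) / Real.log (S : ℝ) ≤ n),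
          RenyiEst.sampleLaw n (p : Fin S → ℝ)
            (RenyiEst.failureEvent α c₁ c₂ δ n (p : Fin S → ℝ))) Filter.atTop
        ≤ ENNReal.ofReal ε := by
  have hαδ : 0 < δ * (α - 1) := mul_pos hδ (by linarith)
  obtain ⟨η, hη₀, hη, hηδ⟩ : ∃ η : ℝ, 0 < η ∧ η ≤ 1 / 2 ∧ 2 * η ≤ δ * (α - 1) :=
    ⟨min (1 / 2) (δ * (α - 1) / 2), by positivity, min_le_left _ _,
      by linarith [min_le_right (1 / 2) (δ * (α - 1) / 2)]⟩
  -- The budget `ε` is split as `ε/2` for the variance and `ε/4` for each of the two remainder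
  -- terms.
  obtain ⟨c, hc, hev⟩ := RenyiEst.exists_parameters hα₁ hα₂ hc₁ hc₂ hc₂' (τ₀ := η / 3)
    (V₀ := ε / 2 * (η / 3) ^ 2) (w₁ := ε / 4 * (η / 3)) (w₂ := ε / 4 * (η / 3))
    (by positivity) (by positivity) (by positivity) (by positivity)
  refine ⟨c, by linarith, Filter.limsup_le_of_le (h := ?_)⟩
  obtain ⟨m₀, hm₀⟩ := Filter.eventually_atTop.1 hev
  have hsqrt : Filter.Tendsto (fun S : ℕ => Real.sqrt (S : ℝ)) Filter.atTop Filter.atTop :=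
    Real.tendsto_sqrt_atTop.comp tendsto_natCast_atTop_atTop
  filter_upwards [hsqrt.eventually_ge_atTop m₀, Filter.eventually_ge_atTop 2] with S hSm hS2
  refine iSup_le fun p => iSup_le fun n => iSup_le fun hn => ?_
  obtain ⟨h1, h2⟩ := RenyiEst.sample_size_bounds hc hS2 hn
  obtain ⟨hm1, hlam, hK, hw₁, hall⟩ := hm₀ (n / 2) (hSm.trans h1)
  obtain ⟨hw₂, hvar, E, hE, hbias⟩ := hall S (by omega) h2
  refine RenyiEst.sampleLaw_failureEvent_le hα₁ hα₂ (by omega) p.2 hη₀ hη hηδ hm1 hlam hK hE rfl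
    hbias hvar hw₁ hw₂ (by positivity) (by positivity) (le_of_eq ?_)
  field_simp
  norm_num
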